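/- All spaces are Banach spaces over the same scalar field $\mathbb{K}\in\{\mathbb{R},\mathbb{C}\}$; $X^*$ denotes the dual of $X$, $L(X,Y)$ the space of bounded linear operators, $\pi_Y\colon Y\to Y^{**}$ the canonical embedding, and $T^*\colon Y^*\to X^*$ the adjoint of $T\in L(X,Y)$. For $p\in[1,\infty]$ let $p'$ be given by $1/p+1/p'=1$. A sequence $(z_k)$ in a Banach space is called absolutely $p$-summing if $\sum_k\|z_k\|^p<\infty$ when $p<\infty$, and if $\|z_k\|\to 0$ when $p=\infty$. An operator $T\in L(X,Y)$ belongs to $N^p(X,Y)$ if $$Tx=\sum_{k=1}^\infty \langle x,x_k'\rangle\, y_k\qquad (x\in X)$$ for some sequences $(x_k')\subset X^*$ and $(y_k)\subset Y$ such that $(y_k)$ is absolutely $p$-summing and $$\sup_{\|x\|\le1}\Bigl(\sum_k|\langle x,x_k'\rangle|^{p'}\Bigr)^{1/p'}<\infty$$ (with $\sup_k|\langle x,x'_k\rangle|$ in place of the inner expression when $p'=\infty$). An operator $S\in L(X,Y)$ is called $p$-nuclear if it has a representation $Sx=\sum_k\langle x,x_k'\rangle y_k$ ($x\in X$) in which instead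 $(x_k')\subset X^*$ is absolutely $p$-summing and $\sup_{y'\in Y^*,\,\|y'\|\le1}\bigl(\sum_k|\langle y_k,y'\rangle|^{p'}\bigr)^{1/p'}<\infty$ (again with a supremum over $k$ when $p'=\infty$). A Banach space has the approximation property if its identity map can be approximated, uniformly on every compact set, by bounded operators of finite rank. **Theorem 1.** Let $p\in[1,\infty]$ and $T\in L(X,Y)$. Then $\pi_Y T\in N^p(X,Y^{**})$ if and only if the adjoint $T^*\colon Y^*\to X^*$ is $p$-nuclear. If, moreover, $X^*$ or $Y^{***}$ has the approximation property, and $\pi_Y T\in N^p(X,Y^{**})$ (equivalently, $T^*$ is $p$-nuclear), then $T\in N^p(X,Y)$. -/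

import Mathlib

set_option maxSynthPendingDepth 3

open Filter Topology
open scoped ENNReal

namespace PNuclear

noncomputable section

/-- The `ℓ_p`-norm of a sequence of vectors, with value in `[0, ∞]`: the supremum of the norms if
`p = ∞`, and `(∑ ‖a k‖ ^ p) ^ (1 / p)` if `1 ≤ p < ∞`. -/
def seqNorm {E : Type*} [NormedAddCommGroup E] (p : ℝ≥0∞) (a : ℕ → E) : ℝ≥0∞ :=
  if p = ∞ then ⨆ k, ‖a k‖ₑ else (∑' k, ‖a k‖ₑ ^ p.toReal) ^ (1 / p.toReal)

/-- Absolutely `p`-summing sequences of vectors: the `ℓ_p`-norm is finite; for `p = ∞` the role of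
`ℓ_∞` is played by `c₀`, that is, the sequence is moreover required to tend to zero. -/
def StronglySummable {E : Type*} [NormedAddCommGroup E] (p : ℝ≥0∞) (a : ℕ → E) : Prop :=
  seqNorm p a < ∞ ∧ (p = ∞ → Tendsto a atTop (𝓝 0))

section

variable {𝕜 : Type*} [RCLike 𝕜]
  {X : Type*} [NormedAddCommGroup X] [NormedSpace 𝕜 X]
  {Y : Type*} [NormedAddCommGroup Y] [NormedSpace 𝕜 Y]

/-- `T : X → Y` is an `N^p`-operator: `T x = ∑ ⟨x, x'_k⟩ y_k` for all `x`, where `(y_k)` is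
absolutely `p`-summing in `Y` and the `ℓ_{p'}`-norms of `(⟨x, x'_k⟩)_k` are bounded over the unit
ball of `X`; here `1 / p + 1 / p' = 1`. By Hölder's inequality the series then converges
absolutely, so that `HasSum` says the same as convergence of its partial sums. -/
def IsNpOperator (p : ℝ≥0∞) (T : X →L[𝕜] Y) : Prop :=
  ∃ (x' : ℕ → StrongDual 𝕜 X) (y : ℕ → Y),
    StronglySummable p y ∧
    (⨆ (x : X) (_ : ‖x‖ ≤ 1), seqNorm p.conjExponent (fun k => x' k x)) < ∞ ∧
    ∀ x : X, HasSum (fun k => x' k x • y k) (T x)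

/-- `S : X → Y` is `p`-nuclear: `S x = ∑ ⟨x, x'_k⟩ y_k` for all `x`, where `(x'_k)` is absolutely
`p`-summing in `X*` and the `ℓ_{p'}`-norms of `(⟨y_k, y'⟩)_k` are bounded over the unit ball
of `Y*`. -/
def IsPNuclear (p : ℝ≥0∞) (S : X →L[𝕜] Y) : Prop :=
  ∃ (x' : ℕ → StrongDual 𝕜 X) (y : ℕ → Y),
    StronglySummable p x' ∧
    (⨆ (y' : StrongDual 𝕜 Y) (_ : ‖y'‖ ≤ 1), seqNorm p.conjExponent (fun k => y' (y k))) < ∞ ∧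
    ∀ x : X, HasSum (fun k => x' k x • y k) (S x)

/-- The Banach-space adjoint `T* : Y* → X*`, `T* y' = y' ∘ T`. -/
def adjointOp (T : X →L[𝕜] Y) : StrongDual 𝕜 Y →L[𝕜] StrongDual 𝕜 X :=
  ContinuousLinearMap.precomp 𝕜 T

end

/-- The Grothendieck approximation property: the identity map is a limit, uniformly on compact
sets, of continuous operators of finite rank. -/
def HasAP (𝕜 : Type*) [RCLike 𝕜] (E : Type*) [NormedAddCommGroup E] [NormedSpace 𝕜 E] : Prop :=
  ∀ K : Set E, IsCompact K → ∀ ε : ℝ, 0 < ε →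
    ∃ F : E →L[𝕜] E, FiniteDimensional 𝕜 (LinearMap.range (F : E →ₗ[𝕜] E)) ∧
      ∀ x ∈ K, ‖F x - x‖ ≤ ε

end

end PNuclear

/-!
The equivalence is a matter of reading: `π_Y T = ∑ x'_k ⊗ y''_k` and `T* = ∑ y''_k ⊗ x'_k` are
the same tensor, and weak `p'`-summability of `(x'_k)` means boundedness of the synthesis
operator `c ↦ ∑ c_k x'_k` on `ℓ_p` (`SynthBound`), whether it is tested on `X` or on `X**`
(`isPNuclear_adjointOp_iff`).

For the second part, let `t = ∑ x'_k ⊗ y''_k` represent `π_Y T`. Two facts are combined.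

* The tensor `t` is a limit of finite tensors `u ∈ X* ⊗ Y`, with respect to the tensor norm of
  `N^p` over `Y**`. If `X*` has the approximation property, `u = ∑ F x'_k ⊗ y''_k` for finite
  rank operators `F` on `X*` close to the identity on a compact set; that this lies in `X* ⊗ Y`
  holds because the second adjoint of `T` maps `X**` into `Y` (`exists_hasRep_of_hasAP_dual`).
  If `Y***` has the approximation property, so does its complemented subspace of functionals
  that annihilate `Y`, and then the image of `t` in `X* ⊗ (Y** / Y)`, which represents the zero
  operator, is zero as a tensor. This is carried out by the Hahn–Banach theorem in the space of
  null sequences of `Y**`, where the approximation property forces the trace of a separating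
  functional to vanish (`eq_zero_of_hasSum_trace`, `exists_approx_modulo_annihilatorSpan`,
  `exists_hasRep_of_hasAP_tripleDual`).
* On `X* ⊗ Y`, the tensor norms over `Y**` and over `Y` are equivalent: a finite representation
  over `Y**` can be pulled down to `Y` with a factor `2`, by a Hahn–Banach argument in the
  spirit of local reflexivity (`exists_sum_eq_of_bidual`, `HasRep.of_bidual`).

Hence the approximants `u` form a Cauchy sequence over `Y`, and concatenating representations of
the successive differences represents `T` (`isNpOperator_of_forall_exists_hasRep`).
-/

namespace PNuclear

noncomputable section

/-! ### The `ℓ_p`-norm of a family of vectors -/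

section FamNorm

variable {ι κ E F : Type*} [NormedAddCommGroup E] [NormedAddCommGroup F] {p : ℝ≥0∞}

/-- The `ℓ_p`-norm of a family of vectors over an arbitrary index type, with value in `[0, ∞]`.
Over `ℕ` it is `seqNorm` by definition; general index types make it possible to concatenate
families. -/
def famNorm (p : ℝ≥0∞) (a : ι → E) : ℝ≥0∞ :=
  if p = ∞ then ⨆ k, ‖a k‖ₑ else (∑' k, ‖a k‖ₑ ^ p.toReal) ^ (1 / p.toReal)

theorem famNorm_top (a : ι → E) : famNorm ∞ a = ⨆ k, ‖a k‖ₑ := if_pos rfl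

theorem famNorm_of_ne_top (hp : p ≠ ∞) (a : ι → E) :
    famNorm p a = (∑' k, ‖a k‖ₑ ^ p.toReal) ^ (1 / p.toReal) := if_neg hp

theorem one_le_toReal (hp : 1 ≤ p) (hp' : p ≠ ∞) : 1 ≤ p.toReal := by
  simpa using ENNReal.toReal_mono hp' hp

/-- Domination up to a constant; this also serves as homogeneity of the norm. -/
theorem famNorm_le_mul (hp : 1 ≤ p) {a : ι → E} {b : ι → F} (C : ℝ≥0∞)
    (h : ∀ k, ‖a k‖ₑ ≤ C * ‖b k‖ₑ) : famNorm p a ≤ C * famNorm p b := by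
  by_cases hp' : p = ∞
  · subst hp'
    rw [famNorm_top, famNorm_top, ENNReal.mul_iSup]
    exact iSup_mono h
  · have h1 := one_le_toReal hp hp'
    have h0 : 0 < p.toReal := by linarith
    rw [famNorm_of_ne_top hp', famNorm_of_ne_top hp']
    calc (∑' k, ‖a k‖ₑ ^ p.toReal) ^ (1 / p.toReal)
        ≤ (∑' k, (C * ‖b k‖ₑ) ^ p.toReal) ^ (1 / p.toReal) := by
          gcongr with k
          exact h k
      _ = C * (∑' k, ‖b k‖ₑ ^ p.toReal) ^ (1 / p.toReal) := by
          simp_rw [ENNReal.mul_rpow_of_nonneg _ _ h0.le]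
          rw [ENNReal.tsum_mul_left, ENNReal.mul_rpow_of_nonneg _ _ (by positivity),
            ← ENNReal.rpow_mul, mul_one_div_cancel h0.ne', ENNReal.rpow_one]

theorem famNorm_mono (hp : 1 ≤ p) {a : ι → E} {b : ι → F}
    (h : ∀ k, ‖a k‖ₑ ≤ ‖b k‖ₑ) : famNorm p a ≤ famNorm p b := by
  simpa using famNorm_le_mul hp 1 (by simpa using h)

theorem le_famNorm (hp : 1 ≤ p) (a : ι → E) (k : ι) : ‖a k‖ₑ ≤ famNorm p a := by
  by_cases hp' : p = ∞
  · subst hp'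
    rw [famNorm_top]
    exact le_iSup (fun k => ‖a k‖ₑ) k
  · have h1 := one_le_toReal hp hp'
    have h0 : 0 < p.toReal := by linarith
    rw [famNorm_of_ne_top hp', one_div, ENNReal.le_rpow_inv_iff h0]
    exact ENNReal.le_tsum (f := fun k => ‖a k‖ₑ ^ p.toReal) k

theorem famNorm_comp_le (hp : 1 ≤ p) (a : κ → E) {f : ι → κ} (hf : f.Injective) :
    famNorm p (fun i => a (f i)) ≤ famNorm p a := by
  by_cases hp' : p = ∞
  · subst hp'
    simp only [famNorm_top]
    exact iSup_comp_le (fun k => ‖a k‖ₑ) f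
  · rw [famNorm_of_ne_top hp', famNorm_of_ne_top hp']
    gcongr
    exact ENNReal.tsum_comp_le_tsum_of_injective hf (fun k => ‖a k‖ₑ ^ p.toReal)

theorem famNorm_extend_le (hp : 1 ≤ p) (a : ι → E) {f : ι → κ} (hf : f.Injective) :
    famNorm p (Function.extend f a 0) ≤ famNorm p a := by
  by_cases hp' : p = ∞
  · subst hp'
    simp only [famNorm_top]
    refine iSup_le fun k => ?_
    by_cases hk : ∃ i, f i = k
    · obtain ⟨i, rfl⟩ := hk
      rw [hf.extend_apply]
      exact le_iSup (fun k => ‖a k‖ₑ) i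
    · simp [Function.extend_apply' _ _ _ hk]
  · have h1 := one_le_toReal hp hp'
    have h0 : 0 < p.toReal := by linarith
    rw [famNorm_of_ne_top hp', famNorm_of_ne_top hp',
      ← hf.tsum_eq (f := fun k => ‖Function.extend f a 0 k‖ₑ ^ p.toReal)]
    · simp only [hf.extend_apply, le_refl]
    · intro k hk
      by_contra hk'
      apply hk
      have : Function.extend f a 0 k = 0 := Function.extend_apply' _ _ _ (by simpa using hk')
      simp [this, h0]

/-- The inclusion `ℓ_1 ⊆ ℓ_r`, with constant one. -/
theorem tsum_rpow_le {r : ℝ} (hr : 1 ≤ r) (N : ι → ℝ≥0∞) :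
    ∑' i, N i ^ r ≤ (∑' i, N i) ^ r := by
  have key : ∀ t : ℝ≥0∞, t ^ r = t * t ^ (r - 1) := fun t => by
    conv_lhs => rw [show r = 1 + (r - 1) by ring,
      ENNReal.rpow_add_of_nonneg _ _ zero_le_one (by linarith), ENNReal.rpow_one]
  calc ∑' i, N i ^ r = ∑' i, N i * N i ^ (r - 1) := by simp_rw [key]
    _ ≤ ∑' i, N i * (∑' i, N i) ^ (r - 1) := by
        refine ENNReal.tsum_le_tsum fun i => ?_
        exact mul_le_mul_right
          (ENNReal.rpow_le_rpow (ENNReal.le_tsum i) (by linarith)) _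
    _ = (∑' i, N i) ^ r := by rw [ENNReal.tsum_mul_right, key]

/-- The norm of a concatenation of families is at most the sum of their norms. -/
theorem famNorm_sigma_le (hp : 1 ≤ p) {κ : ι → Type*} (a : ∀ i, κ i → E) :
    famNorm p (fun x : Σ i, κ i => a x.1 x.2) ≤ ∑' i, famNorm p (a i) := by
  by_cases hp' : p = ∞
  · subst hp'
    rw [famNorm_top]
    refine iSup_le fun x => (le_famNorm hp (a x.1) x.2).trans ?_
    exact ENNReal.le_tsum (f := fun i => famNorm ∞ (a i)) x.1
  · have h1 := one_le_toReal hp hp'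
    have h0 : 0 < p.toReal := by linarith
    rw [famNorm_of_ne_top hp', one_div, ENNReal.rpow_inv_le_iff h0,
      ENNReal.tsum_sigma (fun i k => ‖a i k‖ₑ ^ p.toReal)]
    refine le_trans (le_of_eq ?_) (tsum_rpow_le h1 _)
    congr 1 with i
    rw [famNorm_of_ne_top hp', ← ENNReal.rpow_mul, one_div_mul_cancel h0.ne', ENNReal.rpow_one]

theorem famNorm_sum_le (hp : 1 ≤ p) (a : ι → E) (b : κ → E) :
    famNorm p (Sum.elim a b) ≤ famNorm p a + famNorm p b := by
  by_cases hp' : p = ∞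
  · subst hp'
    simp only [famNorm_top]
    refine iSup_le fun x => ?_
    rcases x with i | k
    · exact le_add_right (le_iSup (fun k => ‖a k‖ₑ) i)
    · exact le_add_left (le_iSup (fun k => ‖b k‖ₑ) k)
  · have h1 := one_le_toReal hp hp'
    have h0 : 0 < p.toReal := by linarith
    rw [famNorm_of_ne_top hp', one_div, ENNReal.rpow_inv_le_iff h0,
      Summable.tsum_sum ENNReal.summable ENNReal.summable]
    refine le_trans (le_of_eq ?_) (ENNReal.add_rpow_le_rpow_add _ _ h1)
    simp only [Sum.elim_inl, Sum.elim_inr]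
    rw [famNorm_of_ne_top hp', ← ENNReal.rpow_mul, one_div_mul_cancel h0.ne', ENNReal.rpow_one,
      famNorm_of_ne_top hp', ← ENNReal.rpow_mul, one_div_mul_cancel h0.ne', ENNReal.rpow_one]

theorem famNorm_le_tsum (hp : 1 ≤ p) (a : ι → E) : famNorm p a ≤ ∑' i, ‖a i‖ₑ := by
  by_cases hp' : p = ∞
  · subst hp'
    rw [famNorm_top]
    exact iSup_le fun i => ENNReal.le_tsum (f := fun i => ‖a i‖ₑ) i
  · have h1 := one_le_toReal hp hp'
    have h0 : 0 < p.toReal := by linarith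
    rw [famNorm_of_ne_top hp', one_div, ENNReal.rpow_inv_le_iff h0]
    exact tsum_rpow_le h1 _

theorem famNorm_one (a : ι → E) : famNorm 1 a = ∑' i, ‖a i‖ₑ := by
  rw [famNorm_of_ne_top ENNReal.one_ne_top]
  simp

/-- Hölder's inequality. -/
theorem tsum_mul_le_famNorm (hp : 1 ≤ p) (a : ι → E) (b : ι → F) :
    ∑' k, ‖a k‖ₑ * ‖b k‖ₑ ≤ famNorm p.conjExponent a * famNorm p b := by
  by_cases hp' : p = ∞
  · subst hp'
    rw [show ENNReal.conjExponent ∞ = 1 by simp [ENNReal.conjExponent], famNorm_one,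
      ← ENNReal.tsum_mul_right]
    refine ENNReal.tsum_le_tsum fun k => ?_
    gcongr
    exact le_famNorm hp b k
  rcases hp.eq_or_lt with rfl | h1
  · rw [show ENNReal.conjExponent 1 = ∞ by simp [ENNReal.conjExponent], famNorm_one,
      ← ENNReal.tsum_mul_left]
    refine ENNReal.tsum_le_tsum fun k => ?_
    gcongr
    exact le_famNorm le_top a k
  have hc : p.HolderConjugate p.conjExponent := .conjExponent hp
  have h1' : 1 < p.toReal := by
    simpa using (ENNReal.toReal_lt_toReal ENNReal.one_ne_top hp').2 h1
  have hr : p.conjExponent.toReal.HolderConjugate p.toReal :=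
    (ENNReal.HolderConjugate.toReal h1').symm
  have hq' : p.conjExponent ≠ ∞ := by
    simpa [ENNReal.conjExponent] using (tsub_pos_of_lt h1).ne'
  rw [famNorm_of_ne_top hp', famNorm_of_ne_top hq', ENNReal.tsum_eq_iSup_sum]
  refine iSup_le fun s => (ENNReal.inner_le_Lp_mul_Lq s _ _ hr).trans ?_
  gcongr
  · exact ENNReal.sum_le_tsum s
  · exact ENNReal.sum_le_tsum s

/-- The tails of an absolutely `p`-summing sequence are small in `ℓ_p`; for `p = ∞` this is where
`c₀` in place of `ℓ_∞` is needed. -/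
theorem exists_famNorm_tail_le (hp : 1 ≤ p) {a : ℕ → E} (ha : StronglySummable p a)
    {ε : ℝ≥0∞} (hε : 0 < ε) :
    ∃ n : ℕ, ∀ m ≥ n, famNorm p ((Set.Ici m).indicator a) ≤ ε := by
  by_cases hp' : p = ∞
  · obtain ⟨-, h⟩ := ha
    have h' : Tendsto (fun k => ‖a k‖ₑ) atTop (𝓝 0) := by
      simpa using (h hp').enorm
    obtain ⟨n, hn⟩ := eventually_atTop.1 (h'.eventually (eventually_le_nhds hε))
    refine ⟨n, fun m hm => ?_⟩
    subst hp'
    rw [famNorm_top]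
    refine iSup_le fun k => ?_
    by_cases hk : m ≤ k
    · simpa [Set.indicator, hk] using hn k (hm.trans hk)
    · simp [Set.indicator, hk]
  · have h1 := one_le_toReal hp hp'
    have h0 : 0 < p.toReal := by linarith
    have hfin : ∑' k, ‖a k‖ₑ ^ p.toReal ≠ ∞ := by
      intro h
      have := ha.1
      change famNorm p a < ∞ at this
      rw [famNorm_of_ne_top hp', h, ENNReal.top_rpow_of_pos (by positivity)] at this
      exact lt_irrefl _ this
    have h2 := ((ENNReal.tendsto_tsum_compl_atTop_zero hfin).comp tendsto_finset_range).eventually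
      (eventually_le_nhds (ENNReal.rpow_pos_of_nonneg (p := p.toReal) hε h0.le))
    obtain ⟨n, hn⟩ := eventually_atTop.1 h2
    refine ⟨n, fun m hm => ?_⟩
    rw [famNorm_of_ne_top hp', one_div, ENNReal.rpow_inv_le_iff h0]
    refine le_trans (le_of_eq ?_) (hn m hm)
    simp only [Function.comp_apply]
    refine Eq.trans ?_ (tsum_subtype {x | x ∉ Finset.range m} (fun k => ‖a k‖ₑ ^ p.toReal)).symm
    congr 1 with k
    by_cases hk : m ≤ k
    · simp [Set.indicator, hk]
    · simp [Set.indicator, hk, h0]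

end FamNorm

/-! ### Duality between `ℓ_p` and `ℓ_{p'}` -/

section Duality

variable {ι κ : Type*} {𝕜 : Type*} [RCLike 𝕜] {E : Type*} [NormedAddCommGroup E] [NormedSpace 𝕜 E]
  {F : Type*} [NormedAddCommGroup F] [NormedSpace 𝕜 F] {p : ℝ≥0∞}

/-- The converse of Hölder's inequality: the `ℓ_{p'}`-norm of a scalar family is determined by
pairing with finitely supported families in `ℓ_p`. -/
theorem famNorm_conj_le_of_sum_le (hp : 1 ≤ p) {b : ι → 𝕜} {C : ℝ≥0∞}
    (h : ∀ (s : Finset ι) (c : ι → 𝕜), (∀ k ∉ s, c k = 0) →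
      ‖∑ k ∈ s, c k * b k‖ₑ ≤ C * famNorm p c) :
    famNorm p.conjExponent b ≤ C := by
  classical
  rcases hp.eq_or_lt with rfl | h1
  · rw [show ENNReal.conjExponent 1 = ∞ by simp [ENNReal.conjExponent], famNorm_top]
    refine iSup_le fun k => ?_
    have := h {k} (Pi.single k 1) (fun j hj => by
      rw [Pi.single_eq_of_ne]; simpa using hj)
    rw [famNorm_one, tsum_eq_single k (fun j hj => by simp [Pi.single_eq_of_ne hj])] at this
    simpa using this
  have hc : p.HolderConjugate p.conjExponent := .conjExponent hp
  set q := p.conjExponent with hq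
  have hq' : q ≠ ∞ := by
    simpa [hq, ENNReal.conjExponent] using (tsub_pos_of_lt h1).ne'
  have hq1 : 1 ≤ q := by simp [hq, ENNReal.conjExponent]
  have hr1 := one_le_toReal hq1 hq'
  set r := q.toReal with hr
  have hr0 : 0 < r := by linarith
  rw [famNorm_of_ne_top hq', one_div, ENNReal.rpow_inv_le_iff hr0, ENNReal.tsum_eq_iSup_sum]
  refine iSup_le fun s => ?_
  set B := ∑ k ∈ s, ‖b k‖ₑ ^ r with hB
  have hBtop : B ≠ ∞ :=
    (ENNReal.sum_lt_top.2 fun k _ => ENNReal.rpow_lt_top_of_nonneg hr0.le (by simp)).ne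
  -- The extremal coefficients in Hölder's inequality: `c k * b k = ‖b k‖ ^ r`. Where `b k = 0`, the
  -- factor `conj (b k)` makes `c k` zero.
  set c : ι → 𝕜 := fun k =>
    if k ∈ s then starRingEnd 𝕜 (b k) * ((‖b k‖ ^ (r - 2) : ℝ) : 𝕜) else 0 with hcdef
  have hcs : ∀ k ∉ s, c k = 0 := fun k hk => by simp [hcdef, hk]
  have hprod : ∀ k ∈ s, c k * b k = ((‖b k‖ ^ r : ℝ) : 𝕜) := by
    intro k hk
    simp only [hcdef, hk, if_true]
    rw [mul_right_comm, RCLike.conj_mul, ← RCLike.ofReal_pow, ← RCLike.ofReal_mul]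
    congr 1
    rcases eq_or_ne (b k) 0 with h0 | h0
    · simp [h0, hr0.ne']
    · rw [← Real.rpow_natCast, ← Real.rpow_add (norm_pos_iff.2 h0)]
      congr 1
      push_cast
      ring
  have hnorm : ∀ k ∈ s, b k ≠ 0 → ‖c k‖ₑ = ‖b k‖ₑ ^ (r - 1) := by
    intro k hk h0
    have h0' : 0 < ‖b k‖ := norm_pos_iff.2 h0
    simp only [hcdef, hk, if_true]
    rw [← ofReal_norm, ← ofReal_norm, ENNReal.ofReal_rpow_of_pos h0', norm_mul,
      RCLike.norm_conj, RCLike.norm_ofReal, abs_of_nonneg (by positivity)]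
    congr 1
    conv_lhs => rw [← Real.rpow_one ‖b k‖, Real.rpow_one]
    rw [show r - 1 = 1 + (r - 2) by ring, Real.rpow_add h0', Real.rpow_one]
  have hsum : ‖∑ k ∈ s, c k * b k‖ₑ = B := by
    rw [Finset.sum_congr rfl hprod, ← RCLike.ofReal_sum, ← ofReal_norm,
      RCLike.norm_ofReal, abs_of_nonneg (by positivity), ENNReal.ofReal_sum_of_nonneg
      (fun _ _ => by positivity)]
    refine Finset.sum_congr rfl fun k _ => ?_
    rw [← ofReal_norm, ENNReal.ofReal_rpow_of_nonneg (norm_nonneg _) hr0.le]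
  have key := h s c hcs
  rw [hsum] at key
  by_cases hB0 : B = 0
  · rw [hB0]; simp
  by_cases hp' : p = ∞
  · have hr1' : r = 1 := by simp [hr, hq, hp', ENNReal.conjExponent]
    have : famNorm p c ≤ 1 := by
      rw [hp', famNorm_top]
      refine iSup_le fun k => ?_
      by_cases hk : k ∈ s
      · rcases eq_or_ne (b k) 0 with h0 | h0
        · simp [hcdef, h0]
        · rw [hnorm k hk h0, hr1']; simp
      · simp [hcs k hk]
    rw [hr1', ENNReal.rpow_one]
    calc B ≤ C * famNorm p c := key
      _ ≤ C * 1 := by gcongr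
      _ = C := mul_one C
  · have h1' : 1 < p.toReal := by
      simpa using (ENNReal.toReal_lt_toReal ENNReal.one_ne_top hp').2 h1
    have hpr : p.toReal.HolderConjugate r := ENNReal.HolderConjugate.toReal h1'
    have hfam : famNorm p c = B ^ (1 / p.toReal) := by
      rw [famNorm_of_ne_top hp']
      congr 1
      rw [tsum_eq_sum (s := s) (fun k hk => by simp [hcs k hk, hpr.pos])]
      refine Finset.sum_congr rfl fun k hk => ?_
      rcases eq_or_ne (b k) 0 with h0 | h0
      · simp [hcdef, h0, hr0, hpr.pos]
      · rw [hnorm k hk h0, ← ENNReal.rpow_mul, hpr.symm.sub_one_mul_conj]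
    rw [hfam] at key
    rw [← ENNReal.rpow_inv_le_iff hr0]
    calc B ^ r⁻¹ = B * B ^ (-(1 / p.toReal)) := by
          rw [← hpr.one_sub_inv, one_div, sub_eq_add_neg, ENNReal.rpow_add _ _ hB0 hBtop,
            ENNReal.rpow_one]
      _ ≤ C * B ^ (1 / p.toReal) * B ^ (-(1 / p.toReal)) := by gcongr
      _ = C := by
          rw [mul_assoc, ← ENNReal.rpow_add _ _ hB0 hBtop]
          simp

variable (𝕜) in
/-- The synthesis operator `c ↦ ∑ c k • x k`, on finitely supported scalar families with the
`ℓ_p`-norm, has norm at most `C`. By the duality of `ℓ_p` and `ℓ_{p'}`, this says that the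
weak `ℓ_{p'}`-norm of the family `x` is at most `C`; unlike the weak norm, it does not refer
to the dual or the predual of `E`. -/
def SynthBound (p : ℝ≥0∞) (x : ι → E) (C : ℝ≥0∞) : Prop :=
  ∀ (s : Finset ι) (c : ι → 𝕜), (∀ k ∉ s, c k = 0) → ‖∑ k ∈ s, c k • x k‖ₑ ≤ C * famNorm p c

theorem SynthBound.mono {x : ι → E} {C D : ℝ≥0∞} (h : SynthBound 𝕜 p x C) (hCD : C ≤ D) :
    SynthBound 𝕜 p x D := fun s c hc => (h s c hc).trans (by gcongr)

/-- The bound for coefficients that need not vanish outside the finite set of summation. -/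
theorem SynthBound.enorm_sum_le {x : ι → E} {C : ℝ≥0∞} (h : SynthBound 𝕜 p x C)
    (s : Finset ι) (c : ι → 𝕜) :
    ‖∑ k ∈ s, c k • x k‖ₑ ≤ C * famNorm p ((s : Set ι).indicator c) := by
  refine le_trans (le_of_eq ?_) (h s ((s : Set ι).indicator c) fun k hk => by simp [hk])
  congr 1
  refine Finset.sum_congr rfl fun k hk => ?_
  simp [hk]

/-- For functionals it suffices to test the weak `ℓ_{p'}`-norm on the unit ball of the predual. -/
theorem synthBound_of_forall_dual (hp : 1 ≤ p) {x' : ι → StrongDual 𝕜 E} {C : ℝ≥0∞}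
    (h : ∀ x : E, ‖x‖ ≤ 1 → famNorm p.conjExponent (fun k => x' k x) ≤ C) :
    SynthBound 𝕜 p x' C := by
  intro s c hc
  by_cases htop : C * famNorm p c = ∞
  · rw [htop]; exact le_top
  have hx : ∀ x : E, ‖x‖ ≤ 1 → ‖(∑ k ∈ s, c k • x' k) x‖ₑ ≤ C * famNorm p c := by
    intro x hx
    calc ‖(∑ k ∈ s, c k • x' k) x‖ₑ = ‖∑ k ∈ s, c k * x' k x‖ₑ := by simp
      _ ≤ ∑ k ∈ s, ‖x' k x‖ₑ * ‖c k‖ₑ := by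
          refine (enorm_sum_le _ _).trans (le_of_eq ?_)
          refine Finset.sum_congr rfl fun k _ => ?_
          rw [enorm_mul, mul_comm]
      _ ≤ ∑' k, ‖x' k x‖ₑ * ‖c k‖ₑ := ENNReal.sum_le_tsum s
      _ ≤ _ := tsum_mul_le_famNorm hp _ _
      _ ≤ _ := by gcongr; exact h x hx
  rw [← ENNReal.ofReal_toReal htop, ← ofReal_norm]
  apply ENNReal.ofReal_le_ofReal
  refine (ContinuousLinearMap.opNorm_bound_of_ball_bound one_pos _ _ fun x hx' => ?_).trans
    (div_one _).le
  rw [← toReal_enorm]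
  exact ENNReal.toReal_mono htop (hx x (by simpa using hx'))

/-- A synthesis bound controls the weak `ℓ_{p'}`-norm. -/
theorem SynthBound.famNorm_le (hp : 1 ≤ p) {x : ι → E} {C : ℝ≥0∞} (h : SynthBound 𝕜 p x C)
    (f : StrongDual 𝕜 E) : famNorm p.conjExponent (fun k => f (x k)) ≤ ‖f‖ₑ * C := by
  refine famNorm_conj_le_of_sum_le hp fun s c hc => ?_
  calc ‖∑ k ∈ s, c k * f (x k)‖ₑ = ‖f (∑ k ∈ s, c k • x k)‖ₑ := by simp
    _ ≤ ‖f‖ₑ * ‖∑ k ∈ s, c k • x k‖ₑ := f.le_opENorm _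
    _ ≤ ‖f‖ₑ * (C * famNorm p c) := by gcongr; exact h s c hc
    _ = _ := (mul_assoc _ _ _).symm

end Duality

/-! ### Weakly `p'`-summable families -/

section SynthBound

variable {ι κ : Type*} {𝕜 : Type*} [RCLike 𝕜] {E : Type*} [NormedAddCommGroup E] [NormedSpace 𝕜 E]
  {F : Type*} [NormedAddCommGroup F] [NormedSpace 𝕜 F] {p : ℝ≥0∞}

theorem SynthBound.smul (hp : 1 ≤ p) {x : ι → E} {C : ℝ≥0∞} (h : SynthBound 𝕜 p x C)
    {a : ι → 𝕜} {L : ℝ≥0∞} (ha : ∀ k, ‖a k‖ₑ ≤ L) :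
    SynthBound 𝕜 p (fun k => a k • x k) (L * C) := by
  intro s c hc
  calc ‖∑ k ∈ s, c k • a k • x k‖ₑ = ‖∑ k ∈ s, (c k * a k) • x k‖ₑ := by simp [mul_smul]
    _ ≤ C * famNorm p (fun k => c k * a k) := h s _ fun k hk => by simp [hc k hk]
    _ ≤ C * (L * famNorm p c) := by
        gcongr
        refine famNorm_le_mul hp L fun k => ?_
        rw [enorm_mul, mul_comm]
        gcongr
        exact ha k
    _ = _ := by ring

theorem SynthBound.comp_injective (hp : 1 ≤ p) {x : κ → E} {C : ℝ≥0∞} (h : SynthBound 𝕜 p x C)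
    {f : ι → κ} (hf : f.Injective) : SynthBound 𝕜 p (fun i => x (f i)) C := by
  intro s c hc
  have := h (s.map ⟨f, hf⟩) (Function.extend f c 0) (by
    intro k hk
    by_cases hk' : ∃ i, f i = k
    · obtain ⟨i, rfl⟩ := hk'
      rw [hf.extend_apply]
      exact hc i fun hi => hk (Finset.mem_map_of_mem ⟨f, hf⟩ hi)
    · simp [Function.extend_apply' _ _ _ hk'])
  simp only [Finset.sum_map, Function.Embedding.coeFn_mk, hf.extend_apply] at this
  exact this.trans (by gcongr; exact famNorm_extend_le hp c hf)

theorem SynthBound.extend (hp : 1 ≤ p) {x : ι → E} {C : ℝ≥0∞} (h : SynthBound 𝕜 p x C)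
    {f : ι → κ} (hf : f.Injective) : SynthBound 𝕜 p (Function.extend f x 0) C := by
  classical
  intro s c hc
  have h1 : ∑ k ∈ s, c k • Function.extend f x 0 k
      = ∑ i ∈ s.preimage f hf.injOn, c (f i) • x i := by
    rw [← Finset.sum_preimage f s hf.injOn (fun k => c k • Function.extend f x 0 k)]
    · simp [hf.extend_apply]
    · intro k _ hk
      simp [Function.extend_apply' x (0 : κ → E) k (by simpa using hk)]
  rw [h1]
  refine (h _ (fun i => c (f i)) fun i hi => hc _ (by simpa using hi)).trans ?_
  gcongr
  exact famNorm_comp_le hp c hf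

theorem SynthBound.sumElim (hp : 1 ≤ p) {x : ι → E} {y : κ → E} {C D : ℝ≥0∞}
    (hx : SynthBound 𝕜 p x C) (hy : SynthBound 𝕜 p y D) :
    SynthBound 𝕜 p (Sum.elim x y) (C + D) := by
  classical
  intro s c hc
  rw [Finset.sum_sum_eq_sum_toLeft_add_sum_toRight, add_mul]
  refine (enorm_add_le _ _).trans (add_le_add ?_ ?_)
  · refine (hx s.toLeft (fun i => c (Sum.inl i)) fun i hi => hc _ (by simpa using hi)).trans ?_
    gcongr
    exact famNorm_comp_le hp c Sum.inl_injective
  · refine (hy s.toRight (fun i => c (Sum.inr i)) fun i hi => hc _ (by simpa using hi)).trans ?_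
    gcongr
    exact famNorm_comp_le hp c Sum.inr_injective

theorem SynthBound.sigma (hp : 1 ≤ p) {κ : ι → Type*} {x : ∀ i, κ i → E} {C : ι → ℝ≥0∞}
    (hx : ∀ i, SynthBound 𝕜 p (x i) (C i)) :
    SynthBound 𝕜 p (fun j : Σ i, κ i => x j.1 j.2) (∑' i, C i) := by
  classical
  intro s c hc
  have hs : s = (s.image Sigma.fst).sigma
      (fun i => s.preimage (Sigma.mk i) sigma_mk_injective.injOn) := by
    ext ⟨i, k⟩
    simp only [Finset.mem_sigma, Finset.mem_image, Finset.mem_preimage]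
    exact ⟨fun h => ⟨⟨_, h, rfl⟩, h⟩, fun h => h.2⟩
  rw [hs, Finset.sum_sigma]
  calc _ ≤ ∑ i ∈ s.image Sigma.fst, ‖∑ k ∈ s.preimage (Sigma.mk i) sigma_mk_injective.injOn,
          c ⟨i, k⟩ • x i k‖ₑ := _root_.enorm_sum_le _ _
    _ ≤ ∑ i ∈ s.image Sigma.fst, C i * famNorm p c := by
        refine Finset.sum_le_sum fun i _ => ?_
        refine (hx i _ (fun k => c ⟨i, k⟩) fun k hk => hc _ (by simpa using hk)).trans ?_
        gcongr
        exact famNorm_comp_le hp c sigma_mk_injective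
    _ ≤ ∑' i, C i * famNorm p c := ENNReal.sum_le_tsum _
    _ = _ := ENNReal.tsum_mul_right

/-- The weak norm is at most the `ℓ_1`-norm; for finite families the latter is finite. -/
theorem synthBound_tsum_enorm (hp : 1 ≤ p) (x : ι → E) : SynthBound 𝕜 p x (∑' k, ‖x k‖ₑ) := by
  intro s c hc
  calc ‖∑ k ∈ s, c k • x k‖ₑ ≤ ∑ k ∈ s, ‖x k‖ₑ * famNorm p c := by
        refine (enorm_sum_le _ _).trans (Finset.sum_le_sum fun k _ => ?_)
        rw [enorm_smul, mul_comm]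
        gcongr
        exact le_famNorm hp c k
    _ ≤ ∑' k, ‖x k‖ₑ * famNorm p c := ENNReal.sum_le_tsum s
    _ = _ := ENNReal.tsum_mul_right

theorem SynthBound.summable_smul [CompleteSpace E] (hp : 1 ≤ p) {x : ℕ → E} {C : ℝ≥0∞}
    (h : SynthBound 𝕜 p x C) (hC : C ≠ ∞) {c : ℕ → 𝕜} (hc : StronglySummable p c) :
    Summable (fun k => c k • x k) := by
  rw [summable_iff_vanishing_norm]
  intro ε hε
  have hδ : 0 < ENNReal.ofReal (ε / 2) / (C + 1) :=
    ENNReal.div_pos (by simpa using hε) (by simp [hC])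
  obtain ⟨n, hn⟩ := exists_famNorm_tail_le hp hc hδ
  refine ⟨Finset.range n, fun t ht => ?_⟩
  have h1 : ‖∑ k ∈ t, c k • x k‖ₑ ≤ ENNReal.ofReal (ε / 2) := by
    calc _ ≤ C * famNorm p ((t : Set ℕ).indicator c) := h.enorm_sum_le t c
      _ ≤ (C + 1) * (ENNReal.ofReal (ε / 2) / (C + 1)) := by
          gcongr
          · simp
          · refine (famNorm_mono hp fun k => ?_).trans (hn n le_rfl)
            by_cases hk : k ∈ t
            · have : n ≤ k := by
                by_contra hlt
                exact Finset.disjoint_left.1 ht hk (by simpa using hlt)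
              simp [hk, this]
            · simp [hk]
      _ = _ := ENNReal.mul_div_cancel (by simp) (by simp [hC])
  rw [← ofReal_norm, ENNReal.ofReal_le_ofReal_iff (by positivity)] at h1
  linarith

theorem StronglySummable.of_le_mul (hp : 1 ≤ p) {a : ℕ → E} {b : ℕ → F} {C : ℝ≥0∞} (hC : C ≠ ∞)
    (hb : StronglySummable p b) (h : ∀ k, ‖a k‖ₑ ≤ C * ‖b k‖ₑ) : StronglySummable p a := by
  refine ⟨(famNorm_le_mul hp C h).trans_lt (ENNReal.mul_lt_top hC.lt_top hb.1), fun hp' => ?_⟩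
  have h1 : Tendsto (fun k => C * ‖b k‖ₑ) atTop (𝓝 (C * 0)) :=
    ENNReal.Tendsto.const_mul (by simpa using (hb.2 hp').enorm) (.inr hC)
  rw [mul_zero] at h1
  rw [tendsto_zero_iff_enorm_tendsto_zero]
  exact tendsto_of_tendsto_of_tendsto_of_le_of_le tendsto_const_nhds h1 (fun _ => zero_le) h

end SynthBound

/-! ### Splitting off a null sequence -/

section Factorization

variable {𝕜 : Type*} [RCLike 𝕜] {E : Type*} [NormedAddCommGroup E] [NormedSpace 𝕜 E] {p : ℝ≥0∞}

theorem stronglySummable_of_summable (hp : 1 ≤ p) (hp' : p ≠ ∞) {a : ℕ → E}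
    (h : Summable fun k => ‖a k‖ ^ p.toReal) : StronglySummable p a := by
  have h1 := one_le_toReal hp hp'
  refine ⟨?_, fun h => absurd h hp'⟩
  change famNorm p a < ∞
  rw [famNorm_of_ne_top hp']
  refine ENNReal.rpow_lt_top_of_nonneg (by positivity) ?_
  simp_rw [← ofReal_norm, ENNReal.ofReal_rpow_of_nonneg (norm_nonneg _) (zero_le_one.trans h1)]
  exact h.tsum_ofReal_ne_top

theorem StronglySummable.summable (hp : 1 ≤ p) (hp' : p ≠ ∞) {a : ℕ → E}
    (h : StronglySummable p a) : Summable fun k => ‖a k‖ ^ p.toReal := by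
  have h1 := one_le_toReal hp hp'
  have h0 : 0 < p.toReal := by linarith
  have h2 : famNorm p a < ∞ := h.1
  rw [famNorm_of_ne_top hp', ENNReal.rpow_lt_top_iff_of_pos (by positivity)] at h2
  simp_rw [← toReal_enorm, ENNReal.toReal_rpow]
  exact ENNReal.summable_toReal h2.ne

theorem stronglySummable_top_of_tendsto {a : ℕ → E} (h : Tendsto a atTop (𝓝 0)) :
    StronglySummable ∞ a := by
  refine ⟨?_, fun _ => h⟩
  change famNorm ∞ a < ∞
  obtain ⟨M, hM⟩ := h.norm.bddAbove_range
  rw [famNorm_top]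
  refine (iSup_le fun k => ?_ : _ ≤ ENNReal.ofReal M).trans_lt ENNReal.ofReal_lt_top
  rw [← ofReal_norm]
  exact ENNReal.ofReal_le_ofReal (hM ⟨k, rfl⟩)

/-- A convergent series with nonnegative terms still converges after division by a suitable null
sequence. With `r k` the `k`-th tail of the series (made positive), `√(r k)` does:
`a k / √(r k)` is at most twice the telescoping difference `√(r k) - √(r (k + 1))`. -/
theorem exists_null_seq_summable_div {a : ℕ → ℝ} (ha : ∀ k, 0 ≤ a k) (hs : Summable a) :
    ∃ l : ℕ → ℝ, (∀ k, 0 < l k) ∧ Tendsto l atTop (𝓝 0) ∧ Summable fun k => a k / l k := by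
  -- The geometric term keeps all tails positive, so that division by `√(r k)` is harmless.
  set b : ℕ → ℝ := fun k => a k + (1 / 2) ^ k with hb
  have hbpos : ∀ k, 0 < b k := fun k => add_pos_of_nonneg_of_pos (ha k) (by positivity)
  have hbs : Summable b := hs.add summable_geometric_two
  set r : ℕ → ℝ := fun k => ∑' j, b (j + k) with hr
  have hr0 : Tendsto r atTop (𝓝 0) := tendsto_sum_nat_add b
  have hstep : ∀ k, r k = b k + r (k + 1) := by
    intro k
    have h1 := ((summable_nat_add_iff k).2 hbs).tsum_eq_zero_add
    simp only [zero_add] at h1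
    simp only [hr]
    rw [h1]
    congr 2
    ext j
    congr 1
    ring
  have hrnn : ∀ k, 0 ≤ r k := fun k => tsum_nonneg fun j => (hbpos _).le
  have hrpos : ∀ k, 0 < r k := fun k => by
    rw [hstep k]; exact add_pos_of_pos_of_nonneg (hbpos k) (hrnn _)
  refine ⟨fun k => √(r k), fun k => Real.sqrt_pos.2 (hrpos k), ?_, ?_⟩
  · simpa using hr0.sqrt
  have hterm : ∀ k, a k / √(r k) ≤ 2 * (√(r k) - √(r (k + 1))) := by
    intro k
    have hs1 := Real.sqrt_pos.2 (hrpos k)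
    rw [div_le_iff₀ hs1]
    have h1 := Real.mul_self_sqrt (hrnn k)
    have h2 := Real.mul_self_sqrt (hrnn (k + 1))
    have h3 := hstep k
    have h4 : a k ≤ b k := by simp [hb]
    nlinarith [sq_nonneg (√(r k) - √(r (k + 1)))]
  refine summable_of_sum_range_le (c := 2 * √(r 0)) (fun k => div_nonneg (ha k) (by positivity))
    fun n => ?_
  calc ∑ k ∈ Finset.range n, a k / √(r k)
      ≤ ∑ k ∈ Finset.range n, 2 * (√(r k) - √(r (k + 1))) :=
        Finset.sum_le_sum fun k _ => hterm k
    _ = 2 * (√(r 0) - √(r n)) := by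
        rw [← Finset.mul_sum, Finset.sum_range_sub' (fun k => √(r k))]
    _ ≤ 2 * √(r 0) := by
        have := Real.sqrt_nonneg (r n)
        linarith

/-- An absolutely `p`-summing sequence remains so after division by a suitable positive null
sequence. -/
theorem StronglySummable.exists_null_factor (hp : 1 ≤ p) {y : ℕ → E} (hy : StronglySummable p y) :
    ∃ l : ℕ → ℝ, (∀ k, 0 < l k) ∧ Tendsto l atTop (𝓝 0) ∧
      ∃ z : ℕ → E, StronglySummable p z ∧ ∀ k, y k = (l k : 𝕜) • z k := by
  have key : ∃ l : ℕ → ℝ, (∀ k, 0 < l k) ∧ Tendsto l atTop (𝓝 0) ∧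
      StronglySummable p fun k => ((l k)⁻¹ : 𝕜) • y k := by
    by_cases hp' : p = ∞
    · subst hp'
      have h0 : Tendsto (fun k : ℕ => √(‖y k‖ + 1 / ((k : ℝ) + 1))) atTop (𝓝 0) := by
        simpa using ((hy.2 rfl).norm.add tendsto_one_div_add_atTop_nhds_zero_nat).sqrt
      have hpos : ∀ k : ℕ, 0 < ‖y k‖ + 1 / ((k : ℝ) + 1) := fun k => by positivity
      refine ⟨_, fun k => Real.sqrt_pos.2 (hpos k), h0, stronglySummable_top_of_tendsto ?_⟩
      refine squeeze_zero_norm (fun k => ?_) h0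
      have h1 := Real.sqrt_pos.2 (hpos k)
      rw [norm_smul, norm_inv, RCLike.norm_ofReal, abs_of_pos h1, inv_mul_le_iff₀ h1,
        Real.mul_self_sqrt (hpos k).le]
      have : (0 : ℝ) ≤ 1 / ((k : ℝ) + 1) := by positivity
      linarith
    · have h1 := one_le_toReal hp hp'
      have h0 : 0 < p.toReal := by linarith
      obtain ⟨l, hl, hl0, hls⟩ := exists_null_seq_summable_div (fun k => by positivity)
        (hy.summable hp hp')
      refine ⟨fun k => l k ^ (1 / p.toReal), fun k => Real.rpow_pos_of_pos (hl k) _, ?_,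
        stronglySummable_of_summable hp hp' ?_⟩
      · have := hl0.rpow_const (p := 1 / p.toReal) (.inr (by positivity))
        rwa [Real.zero_rpow (by positivity)] at this
      · refine hls.congr fun k => ?_
        have h2 := Real.rpow_pos_of_pos (hl k) (1 / p.toReal)
        rw [norm_smul, norm_inv, RCLike.norm_ofReal, abs_of_pos h2,
          Real.mul_rpow (by positivity) (by positivity), Real.inv_rpow h2.le,
          ← Real.rpow_mul (hl k).le,
          one_div_mul_cancel h0.ne', Real.rpow_one, div_eq_inv_mul]
  obtain ⟨l, hl, hl0, hls⟩ := key
  refine ⟨l, hl, hl0, _, hls, fun k => ?_⟩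
  rw [smul_inv_smul₀]
  exact_mod_cast (hl k).ne'

/-- An absolutely `p`-summing sequence of vectors is the product of a `p`-summing scalar sequence
and a null sequence of vectors. -/
theorem StronglySummable.exists_eq_smul_null (hp : 1 ≤ p) {y : ℕ → E} (hy : StronglySummable p y) :
    ∃ (m : ℕ → 𝕜) (v : ℕ → E), StronglySummable p m ∧ Tendsto v atTop (𝓝 0) ∧
      ∀ k, y k = m k • v k := by
  obtain ⟨l, hl, hl0, z, hz, hyz⟩ := hy.exists_null_factor (𝕜 := 𝕜) hp
  refine ⟨fun k => (‖z k‖ : 𝕜), fun k => ((l k / ‖z k‖ : ℝ) : 𝕜) • z k,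
    hz.of_le_mul hp ENNReal.one_ne_top fun k => ?_, squeeze_zero_norm (fun k => ?_) hl0,
    fun k => ?_⟩
  · rw [one_mul, ← ofReal_norm, ← ofReal_norm]
    simp
  · rw [norm_smul, RCLike.norm_ofReal, abs_of_nonneg (div_nonneg (hl k).le (norm_nonneg _))]
    rcases eq_or_ne ‖z k‖ 0 with h | h
    · simp [h, (hl k).le]
    · rw [div_mul_cancel₀ _ h]
  · rw [hyz k, smul_smul]
    rcases eq_or_ne (z k) 0 with h | h
    · simp [h]
    · congr 1
      rw [← RCLike.ofReal_mul, mul_div_cancel₀ _ (norm_ne_zero_iff.2 h)]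

end Factorization

/-! ### Representations of an operator and of its adjoint -/

section Adjoint

variable {𝕜 : Type*} [RCLike 𝕜]
  {X : Type*} [NormedAddCommGroup X] [NormedSpace 𝕜 X]
  {Y : Type*} [NormedAddCommGroup Y] [NormedSpace 𝕜 Y] {p : ℝ≥0∞}

open NormedSpace

theorem synthBound_of_iSup_lt_top (hp : 1 ≤ p) {x' : ℕ → StrongDual 𝕜 X}
    (h : (⨆ (x : X) (_ : ‖x‖ ≤ 1), seqNorm p.conjExponent (fun k => x' k x)) < ∞) :
    ∃ C : ℝ≥0∞, C ≠ ∞ ∧ SynthBound 𝕜 p x' C :=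
  ⟨_, h.ne, synthBound_of_forall_dual hp fun x hx =>
    le_iSup₂ (f := fun (x : X) (_ : ‖x‖ ≤ 1) => seqNorm p.conjExponent (fun k => x' k x)) x hx⟩

theorem SynthBound.iSup_lt_top (hp : 1 ≤ p) {x : ℕ → X} {C : ℝ≥0∞} (hC : C ≠ ∞)
    (h : SynthBound 𝕜 p x C) :
    (⨆ (f : StrongDual 𝕜 X) (_ : ‖f‖ ≤ 1), seqNorm p.conjExponent (fun k => f (x k))) < ∞ := by
  refine lt_of_le_of_lt (iSup₂_le fun f hf => ?_) hC.lt_top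
  refine (h.famNorm_le hp f).trans ?_
  have : ‖f‖ₑ ≤ 1 := by
    rw [← ofReal_norm]; exact ENNReal.ofReal_le_one.2 hf
  calc ‖f‖ₑ * C ≤ 1 * C := by gcongr
    _ = C := one_mul C

theorem enorm_inclusionInDoubleDual_le (x : X) : ‖inclusionInDoubleDual 𝕜 X x‖ₑ ≤ ‖x‖ₑ := by
  rw [← ofReal_norm, ← ofReal_norm]
  exact ENNReal.ofReal_le_ofReal (double_dual_bound 𝕜 X x)

theorem SynthBound.iSup_dual_lt_top (hp : 1 ≤ p) {x' : ℕ → StrongDual 𝕜 X} {C : ℝ≥0∞} (hC : C ≠ ∞)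
    (h : SynthBound 𝕜 p x' C) :
    (⨆ (x : X) (_ : ‖x‖ ≤ 1), seqNorm p.conjExponent (fun k => x' k x)) < ∞ := by
  refine lt_of_le_of_lt (iSup₂_le fun x hx => ?_) (h.iSup_lt_top hp hC)
  exact le_iSup₂ (f := fun (f : StrongDual 𝕜 (StrongDual 𝕜 X)) (_ : ‖f‖ ≤ 1) =>
    seqNorm p.conjExponent (fun k => f (x' k))) (inclusionInDoubleDual 𝕜 X x)
    ((double_dual_bound 𝕜 X x).trans hx)

theorem StronglySummable.apply (hp : 1 ≤ p) {f : ℕ → StrongDual 𝕜 X} (hf : StronglySummable p f)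
    (x : X) : StronglySummable p (fun k => f k x) := by
  refine hf.of_le_mul hp (C := ‖x‖ₑ) (by simp) fun k => ?_
  rw [mul_comm]
  exact (f k).le_opENorm x

theorem SynthBound.summable_apply_smul [CompleteSpace Y] (hp : 1 ≤ p) {x' : ℕ → StrongDual 𝕜 X}
    {C : ℝ≥0∞} (hC : C ≠ ∞) (h : SynthBound 𝕜 p x' C) {y : ℕ → Y} (hy : StronglySummable p y)
    (f : StrongDual 𝕜 (StrongDual 𝕜 X)) : Summable (fun k => f (x' k) • y k) := by
  apply Summable.of_enorm
  simp_rw [enorm_smul]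
  refine ((tsum_mul_le_famNorm hp (fun k => f (x' k)) y).trans_lt ?_).ne
  refine ENNReal.mul_lt_top ((h.famNorm_le hp f).trans_lt ?_) hy.1
  exact ENNReal.mul_lt_top (by simp) hC.lt_top

theorem hasSum_apply {f : ℕ → StrongDual 𝕜 X} {g : StrongDual 𝕜 X} (h : HasSum f g) (x : X) :
    HasSum (fun k => f k x) (g x) := h.mapL (inclusionInDoubleDual 𝕜 X x)

/-- A representation `∑ x'_k ⊗ y''_k` of `π_Y T` and a representation `∑ y''_k ⊗ x'_k` of `T*` are
the same data. Weak summability of `(x'_k)` may be tested on `X` or on `X**`, with the same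
result. -/
theorem isPNuclear_adjointOp_iff (hp : 1 ≤ p) (T : X →L[𝕜] Y) :
    IsNpOperator p ((inclusionInDoubleDual 𝕜 Y).comp T) ↔ IsPNuclear p (adjointOp T) := by
  constructor
  · rintro ⟨x', y, hy, hx, hT⟩
    obtain ⟨C, hC, hsb⟩ := synthBound_of_iSup_lt_top hp hx
    refine ⟨y, x', hy, hsb.iSup_lt_top hp hC, fun g => ?_⟩
    have hs := hsb.summable_smul hp hC (hy.apply hp g)
    convert hs.hasSum
    ext x
    refine (hasSum_apply (hT x) g).unique ?_
    convert hasSum_apply hs.hasSum x using 2 with k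
    simp [mul_comm]
  · rintro ⟨y, x', hy, hx, hT⟩
    have hx' : (⨆ (x : X) (_ : ‖x‖ ≤ 1), seqNorm p.conjExponent (fun k => x' k x)) < ∞ := by
      refine lt_of_le_of_lt (iSup₂_le fun x hx => ?_) hx
      exact le_iSup₂ (f := fun (f : StrongDual 𝕜 (StrongDual 𝕜 X)) (_ : ‖f‖ ≤ 1) =>
        seqNorm p.conjExponent (fun k => f (x' k))) (inclusionInDoubleDual 𝕜 X x)
        ((double_dual_bound 𝕜 X x).trans hx)
    obtain ⟨C, hC, hsb⟩ := synthBound_of_iSup_lt_top hp hx'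
    refine ⟨x', y, hy, hx', fun x => ?_⟩
    have hs : Summable (fun k => x' k x • y k) :=
      hsb.summable_apply_smul hp hC hy (inclusionInDoubleDual 𝕜 X x)
    have hsum : (inclusionInDoubleDual 𝕜 Y).comp T x = ∑' k, x' k x • y k := by
      refine ContinuousLinearMap.ext fun g => ?_
      refine (hasSum_apply (hT g) x).unique ?_
      convert hasSum_apply hs.hasSum g using 2 with k
      simp [mul_comm]
    rw [hsum]
    exact hs.hasSum

end Adjoint

/-! ### Finite representations and their descent from the bidual -/

section FiniteRep

variable {𝕜 : Type*} [RCLike 𝕜]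
  {X : Type*} [NormedAddCommGroup X] [NormedSpace 𝕜 X]
  {Y : Type*} [NormedAddCommGroup Y] [NormedSpace 𝕜 Y] {p : ℝ≥0∞}

open NormedSpace

/-- The operator `S` is a finite sum `∑ x'_i ⊗ y_i` in which the weak `ℓ_{p'}`-norm of `(x'_i)`
and the `ℓ_p`-norm of `(y_i)` are both at most `ε`. Requiring the same bound for the two
factors makes this additive under concatenation; the size of the tensor is `ε ^ 2`. -/
def HasRep (p : ℝ≥0∞) (S : X →L[𝕜] Y) (ε : ℝ≥0∞) : Prop :=
  ∃ (ι : Type) (_ : Fintype ι) (x' : ι → StrongDual 𝕜 X) (y : ι → Y),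
    SynthBound 𝕜 p x' ε ∧ famNorm p y ≤ ε ∧ ∀ x, S x = ∑ i, x' i x • y i

theorem HasRep.add (hp : 1 ≤ p) {S S' : X →L[𝕜] Y} {ε ε' : ℝ≥0∞} (h : HasRep p S ε)
    (h' : HasRep p S' ε') : HasRep p (S + S') (ε + ε') := by
  obtain ⟨ι, _, x', y, hx, hy, hS⟩ := h
  obtain ⟨κ, _, u', z, hu, hz, hS'⟩ := h'
  refine ⟨ι ⊕ κ, inferInstance, Sum.elim x' u', Sum.elim y z, hx.sumElim hp hu,
    (famNorm_sum_le hp y z).trans (add_le_add hy hz), fun x => ?_⟩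
  simp [hS, hS']

theorem HasRep.neg (hp : 1 ≤ p) {S : X →L[𝕜] Y} {ε : ℝ≥0∞} (h : HasRep p S ε) :
    HasRep p (-S) ε := by
  obtain ⟨ι, _, x', y, hx, hy, hS⟩ := h
  refine ⟨ι, ‹_›, x', fun i => - y i, hx, (famNorm_mono hp (by simp)).trans hy, fun x => ?_⟩
  simp [hS]

theorem HasRep.sub (hp : 1 ≤ p) {S S' : X →L[𝕜] Y} {ε ε' : ℝ≥0∞} (h : HasRep p S ε)
    (h' : HasRep p S' ε') : HasRep p (S - S') (ε + ε') := by
  rw [sub_eq_add_neg]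
  exact h.add hp (h'.neg hp)

/-- Only the product of the two bounds matters, since scalars may be moved between the factors. -/
theorem hasRep_of_mul_le (hp : 1 ≤ p) {ι : Type} [Fintype ι] {S : X →L[𝕜] Y}
    {x' : ι → StrongDual 𝕜 X} {y : ι → Y} {A B ε : ℝ≥0∞} (hx : SynthBound 𝕜 p x' A)
    (hy : famNorm p y ≤ B) (hA : A ≠ ∞) (hB : B ≠ ∞) (hε : ε ≠ 0) (hε' : ε ≠ ∞)
    (hAB : A * B ≤ ε * ε) (hS : ∀ x, S x = ∑ i, x' i x • y i) : HasRep p S ε := by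
  have key : ∃ c : ℝ≥0∞, c ≠ 0 ∧ c ≠ ∞ ∧ c * A ≤ ε ∧ c⁻¹ * B ≤ ε := by
    by_cases hB0 : B = 0
    · refine ⟨ε / (A + 1), ?_, ?_, ?_, by simp [hB0]⟩
      · exact (ENNReal.div_pos hε (by simp [hA])).ne'
      · exact (ENNReal.div_lt_top hε' (by simp)).ne
      · calc ε / (A + 1) * A ≤ ε / (A + 1) * (A + 1) := by gcongr; simp
          _ = ε := ENNReal.div_mul_cancel (by simp) (by simp [hA])
    · refine ⟨B / ε, (ENNReal.div_pos hB0 hε').ne', (ENNReal.div_lt_top hB hε).ne, ?_, ?_⟩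
      · rw [div_eq_mul_inv, mul_right_comm, mul_comm B A, ← div_eq_mul_inv]
        exact ENNReal.div_le_of_le_mul hAB
      · rw [ENNReal.inv_div (.inl hε') (.inl hε), ENNReal.div_mul_cancel hB0 hB]
  obtain ⟨c, hc0, hctop, hcA, hcB⟩ := key
  have hcr : 0 < c.toReal := ENNReal.toReal_pos hc0 hctop
  have hcn : ‖(c.toReal : 𝕜)‖ₑ = c := by
    rw [← ofReal_norm, RCLike.norm_ofReal, abs_of_pos hcr, ENNReal.ofReal_toReal hctop]
  have hc𝕜 : (c.toReal : 𝕜) ≠ 0 := by exact_mod_cast hcr.ne'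
  refine ⟨ι, ‹_›, fun i => (c.toReal : 𝕜) • x' i, fun i => (c.toReal : 𝕜)⁻¹ • y i,
    (hx.smul hp fun _ => hcn.le).mono hcA, ?_, fun x => ?_⟩
  · refine (famNorm_le_mul hp c⁻¹ fun k => ?_).trans (le_trans (by gcongr) hcB)
    rw [enorm_smul, enorm_inv hc𝕜, hcn]
  · rw [hS]
    refine Finset.sum_congr rfl fun i _ => ?_
    simp only [_root_.smul_apply, smul_smul, smul_eq_mul]
    rw [mul_right_comm, mul_inv_cancel₀ hc𝕜, one_mul]

theorem hasRep_of_finite (hp : 1 ≤ p) {ι : Type} [Fintype ι] {S : X →L[𝕜] Y}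
    {x' : ι → StrongDual 𝕜 X} {y : ι → Y} (hS : ∀ x, S x = ∑ i, x' i x • y i) :
    ∃ M : ℝ≥0∞, M ≠ ∞ ∧ HasRep p S M := by
  refine ⟨∑' i, ‖x' i‖ₑ + ∑' i, ‖y i‖ₑ, ?_, ι, ‹_›, x', y,
    (synthBound_tsum_enorm hp x').mono le_self_add, (famNorm_le_tsum hp y).trans le_add_self, hS⟩
  simp [tsum_fintype, ENNReal.sum_eq_top]

theorem HasRep.enorm_apply_le (hp : 1 ≤ p) {S : X →L[𝕜] Y} {ε : ℝ≥0∞} (h : HasRep p S ε) (x : X) :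
    ‖S x‖ₑ ≤ ‖x‖ₑ * ε * ε := by
  obtain ⟨ι, _, x', y, hx, hy, hS⟩ := h
  calc ‖S x‖ₑ ≤ ∑ i, ‖x' i x‖ₑ * ‖y i‖ₑ := by
        rw [hS]
        refine (enorm_sum_le _ _).trans (le_of_eq ?_)
        simp_rw [enorm_smul]
    _ ≤ ∑' i, ‖x' i x‖ₑ * ‖y i‖ₑ := ENNReal.sum_le_tsum _
    _ ≤ famNorm p.conjExponent (fun i => x' i x) * famNorm p y := tsum_mul_le_famNorm hp _ _
    _ ≤ ‖inclusionInDoubleDual 𝕜 X x‖ₑ * ε * ε := by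
        gcongr
        exact hx.famNorm_le hp (inclusionInDoubleDual 𝕜 X x)
    _ ≤ _ := by gcongr; exact enorm_inclusionInDoubleDual_le x

theorem sum_smul_eq_sum_smul_sum {ι κ : Type*} [Fintype ι] [Fintype κ] {r : ι → 𝕜} {c : κ → 𝕜}
    {b : κ → ι → 𝕜} (h : r = ∑ i, c i • b i) (z : ι → Y) :
    ∑ k, r k • z k = ∑ i, c i • ∑ k, b i k • z k := by
  subst h
  simp only [Finset.sum_apply, Pi.smul_apply, Finset.sum_smul, Finset.smul_sum, smul_assoc]
  exact Finset.sum_comm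

/-- The norm of a functional is dominated by a value at a vector of norm less than `2`. -/
theorem exists_norm_lt_two_norm_le_re (g : StrongDual 𝕜 Y) :
    ∃ y : Y, ‖y‖ < 2 ∧ ‖g‖ ≤ RCLike.re (g y) := by
  by_cases h0 : g = 0
  · exact ⟨0, by simp, by simp [h0]⟩
  have hpos : 0 < ‖g‖ := norm_pos_iff.2 h0
  obtain ⟨y, hy1, hy2⟩ := g.exists_lt_apply_of_lt_opNorm (half_lt_self hpos)
  have hgy : ‖g y‖ ≠ 0 := fun h => by
    rw [h] at hy2; linarith
  have hphase : (starRingEnd 𝕜 (g y) * (‖g y‖ : 𝕜)⁻¹) * g y = (‖g y‖ : 𝕜) := by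
    rw [mul_right_comm, RCLike.conj_mul, pow_two, mul_assoc,
      mul_inv_cancel₀ (by exact_mod_cast hgy), mul_one]
  refine ⟨(2 : 𝕜) • (starRingEnd 𝕜 (g y) * (‖g y‖ : 𝕜)⁻¹) • y, ?_, ?_⟩
  · rw [norm_smul, norm_smul, norm_mul, norm_inv, RCLike.norm_conj, RCLike.norm_ofReal, abs_norm,
      mul_inv_cancel₀ hgy, RCLike.norm_ofNat]
    linarith
  · rw [(g).map_smul, (g).map_smul, smul_eq_mul, smul_eq_mul, hphase]
    have : RCLike.re ((2 : 𝕜) * (‖g y‖ : 𝕜)) = 2 * ‖g y‖ := by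
      rw [← RCLike.ofReal_ofNat, ← RCLike.ofReal_mul, RCLike.ofReal_re]
    rw [this]
    linarith

/-- A form of local reflexivity: if finitely many vectors `w k` in the unit ball of `Y**` satisfy
linear conditions `∑ r k • w k ∈ Y`, then the same values are attained by vectors `u k ∈ Y` of
norm at most `2`. Otherwise Hahn–Banach separates the prescribed values from the open convex
set of attained ones, and the separating functional, read in `Y**`, contradicts `‖w k‖ ≤ 1`. -/
theorem exists_sum_eq_of_bidual [CompleteSpace Y] {ι : Type*} [Fintype ι]
    (R : Submodule 𝕜 (ι → 𝕜)) (w : ι → StrongDual 𝕜 (StrongDual 𝕜 Y)) (hw : ∀ k, ‖w k‖ ≤ 1)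
    (h : ∀ r ∈ R, ∃ y, inclusionInDoubleDual 𝕜 Y y = ∑ k, r k • w k) :
    ∃ u : ι → Y, (∀ k, ‖u k‖ ≤ 2) ∧
      ∀ r ∈ R, inclusionInDoubleDual 𝕜 Y (∑ k, r k • u k) = ∑ k, r k • w k := by
  classical
  let _ : NormedSpace ℝ Y := NormedSpace.restrictScalars ℝ 𝕜 Y
  have : IsScalarTower ℝ 𝕜 Y := IsScalarTower.of_algebraMap_smul fun _ _ => rfl
  let b := Module.finBasis 𝕜 R
  let A : (ι → Y) →L[𝕜] (Fin (Module.finrank 𝕜 R) → Y) :=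
    ContinuousLinearMap.pi fun i => ∑ k, (b i : ι → 𝕜) k • ContinuousLinearMap.proj k
  have hA : ∀ u i, A u i = ∑ k, (b i : ι → 𝕜) k • u k := fun u i => by
    simp [A]
  -- The rows of `A` are a basis of `R`, so they have a linear left inverse, which yields a right
  -- inverse of `A` by acting on coordinates.
  have hsurj : Function.Surjective A := by
    obtain ⟨g, hg⟩ := LinearMap.exists_leftInverse_of_injective R.subtype
      (LinearMap.ker_eq_bot.2 R.injective_subtype)
    intro v
    refine ⟨fun k => ∑ i, b.repr (g (Pi.single k 1)) i • v i, ?_⟩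
    ext i
    rw [hA]
    have h1 : ∀ j, ∑ k, (b i : ι → 𝕜) k * b.repr (g (Pi.single k 1)) j =
        if j = i then 1 else 0 := by
      intro j
      have h2 : g (b i : ι → 𝕜) = b i := LinearMap.congr_fun hg (b i)
      have h3 : (b i : ι → 𝕜) = ∑ k, (b i : ι → 𝕜) k • Pi.single k 1 := by
        exact pi_eq_sum_univ' _
      have h4 : b.repr (g (b i : ι → 𝕜)) j = if j = i then 1 else 0 := by
        rw [h2, b.repr_self, Finsupp.single_apply]
        simp [eq_comm]
      rw [← h4]
      conv_rhs => rw [h3]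
      simp
    simp_rw [Finset.smul_sum, smul_smul]
    rw [Finset.sum_comm]
    simp_rw [← Finset.sum_smul, h1]
    simp
  have hv : ∀ i, ∃ y, inclusionInDoubleDual 𝕜 Y y = ∑ k, (b i : ι → 𝕜) k • w k :=
    fun i => h _ (b i).2
  choose v hv using hv
  have hmem : v ∈ A '' Metric.ball 0 2 := by
    by_contra hnot
    have hconv : Convex ℝ (A '' Metric.ball 0 2) :=
      (convex_ball (0 : ι → Y) 2).linear_image (A.toLinearMap.restrictScalars ℝ)
    obtain ⟨f, hf⟩ := RCLike.geometric_hahn_banach_open_point (𝕜 := 𝕜) hconv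
      (A.isOpenMap hsurj _ Metric.isOpen_ball) hnot
    let g : ι → StrongDual 𝕜 Y := fun k =>
      (f.comp A).comp (ContinuousLinearMap.single 𝕜 (fun _ : ι => Y) k)
    let f' : Fin (Module.finrank 𝕜 R) → StrongDual 𝕜 Y := fun i =>
      f.comp (ContinuousLinearMap.single 𝕜 (fun _ => Y) i)
    have hfg : ∀ u, f (A u) = ∑ k, g k (u k) := by
      intro u
      conv_lhs => rw [← Finset.univ_sum_single u]
      simp [g]
    have hff : ∀ z, f z = ∑ i, f' i (z i) := by
      intro z
      conv_lhs => rw [← Finset.univ_sum_single z]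
      simp [f']
    have hgf : ∀ k, g k = ∑ i, (b i : ι → 𝕜) k • f' i := by
      intro k
      ext y
      have : g k y = f (A (Pi.single k y)) := rfl
      rw [this, hff]
      simp [hA, Pi.single_apply]
    have hfv : f v = ∑ k, w k (g k) := by
      rw [hff]
      calc ∑ i, f' i (v i) = ∑ i, (∑ k, (b i : ι → 𝕜) k • w k) (f' i) := by
            simp_rw [← hv]; rfl
        _ = ∑ k, w k (g k) := by
            simp_rw [hgf]
            simp only [_root_.sum_apply, _root_.smul_apply, map_sum, map_smul]
            rw [Finset.sum_comm]
    choose u hu1 hu2 using fun k => exists_norm_lt_two_norm_le_re (g k)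
    have hu : u ∈ Metric.ball (0 : ι → Y) 2 := by
      rw [mem_ball_zero_iff, pi_norm_lt_iff two_pos]
      exact hu1
    have h1 := hf _ ⟨u, hu, rfl⟩
    rw [hfg, hfv, map_sum, map_sum] at h1
    refine absurd h1 (not_lt.2 (Finset.sum_le_sum fun k _ => ?_))
    calc RCLike.re (w k (g k)) ≤ ‖w k (g k)‖ := RCLike.re_le_norm _
      _ ≤ ‖w k‖ * ‖g k‖ := (w k).le_opNorm _
      _ ≤ 1 * ‖g k‖ := by gcongr; exact hw k
      _ = ‖g k‖ := one_mul _
      _ ≤ _ := hu2 k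
  obtain ⟨u, hu, huv⟩ := hmem
  refine ⟨u, fun k => (norm_le_pi_norm u k).trans (mem_ball_zero_iff.1 hu).le, fun r hr => ?_⟩
  have hb : ∀ i, inclusionInDoubleDual 𝕜 Y (∑ k, (b i : ι → 𝕜) k • u k)
      = ∑ k, (b i : ι → 𝕜) k • w k := by
    intro i
    rw [← hA, huv, hv]
  have hr' : r = ∑ i, b.repr ⟨r, hr⟩ i • (b i : ι → 𝕜) := by
    conv_lhs => rw [show r = ((⟨r, hr⟩ : R) : ι → 𝕜) from rfl, ← b.sum_repr ⟨r, hr⟩]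
    simp only [Submodule.coe_sum, Submodule.coe_smul]
  rw [sum_smul_eq_sum_smul_sum hr' u, map_sum, sum_smul_eq_sum_smul_sum hr' w]
  simp_rw [map_smul, hb]

/-- A finite representation with vectors in `Y**` of an operator into `Y` can be replaced by one
with vectors in `Y`, at the cost of a factor `2`. -/
theorem HasRep.of_bidual [CompleteSpace Y] (hp : 1 ≤ p) {S : X →L[𝕜] Y} {ε : ℝ≥0∞}
    (h : HasRep p ((inclusionInDoubleDual 𝕜 Y).comp S) ε) : HasRep p S (2 * ε) := by
  obtain ⟨ι, _, x', y, hx, hy, hS⟩ := h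
  -- The norms `‖y k‖` are absorbed into the functionals, so that the vectors to be replaced are
  -- normalized; the vectors with `y k = 0` are then replaced by `0`.
  let R : Submodule 𝕜 (ι → 𝕜) :=
    LinearMap.range (LinearMap.pi fun k => (‖y k‖ : 𝕜) • (x' k : X →ₗ[𝕜] 𝕜))
  have hn : ∀ k, (‖y k‖ : 𝕜) • (‖y k‖⁻¹ : 𝕜) • y k = y k := by
    intro k
    by_cases h0 : y k = 0
    · simp [h0]
    · rw [smul_inv_smul₀]
      exact_mod_cast norm_ne_zero_iff.2 h0
  obtain ⟨u, hu, hRu⟩ := exists_sum_eq_of_bidual R (fun k => (‖y k‖⁻¹ : 𝕜) • y k)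
    (fun k => by
      by_cases h0 : y k = 0
      · simp [h0]
      · rw [norm_smul, norm_inv, RCLike.norm_ofReal, abs_norm,
          inv_mul_cancel₀ (norm_ne_zero_iff.2 h0)])
    (by
      rintro _ ⟨x, rfl⟩
      refine ⟨S x, ?_⟩
      have := hS x
      simp only [ContinuousLinearMap.comp_apply] at this
      rw [this]
      refine Finset.sum_congr rfl fun k _ => ?_
      conv_lhs => rw [← hn k]
      simp only [LinearMap.pi_apply, LinearMap.smul_apply, ContinuousLinearMap.coe_coe,
        smul_smul, smul_eq_mul]
      congr 1
      ring)
  refine ⟨ι, ‹_›, x', fun k => (‖y k‖ : 𝕜) • u k, hx.mono ?_, ?_, fun x => ?_⟩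
  · rw [two_mul]; exact le_self_add
  · refine (famNorm_le_mul hp 2 fun k => ?_).trans (mul_le_mul_right hy 2)
    have h1 : ‖(‖y k‖ : 𝕜)‖ₑ = ‖y k‖ₑ := by
      rw [← ofReal_norm, ← ofReal_norm]; simp
    rw [enorm_smul, h1, mul_comm]
    gcongr
    rw [← ofReal_norm]
    exact ENNReal.ofReal_le_of_le_toReal (by simpa using hu k)
  · apply (inclusionInDoubleDualLi 𝕜 (E := Y)).injective
    have h1 := hRu _ ⟨x, rfl⟩
    have h2 := hS x
    simp only [ContinuousLinearMap.comp_apply] at h2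
    change inclusionInDoubleDual 𝕜 Y _ = inclusionInDoubleDual 𝕜 Y _
    rw [h2]
    simp only [LinearMap.pi_apply, LinearMap.smul_apply, ContinuousLinearMap.coe_coe,
      smul_eq_mul] at h1
    calc ∑ i, x' i x • y i = ∑ k, ((‖y k‖ : 𝕜) * x' k x) • (‖y k‖⁻¹ : 𝕜) • y k := by
          refine Finset.sum_congr rfl fun k _ => ?_
          conv_lhs => rw [← hn k]
          simp only [smul_smul]
          congr 1
          ring
      _ = _ := by
          rw [← h1]
          congr 1
          refine Finset.sum_congr rfl fun k _ => ?_
          rw [mul_comm, mul_smul]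

end FiniteRep

/-! ### Operators approximated by finite representations -/

section Concatenation

variable {𝕜 : Type*} [RCLike 𝕜]
  {X : Type*} [NormedAddCommGroup X] [NormedSpace 𝕜 X]
  {Y : Type*} [NormedAddCommGroup Y] [NormedSpace 𝕜 Y] {p : ℝ≥0∞}

open NormedSpace

/-- A sum of operators with finite representations of summable sizes is an `N^p`-operator:
concatenate the representations. -/
theorem isNpOperator_of_hasRep_sum [CompleteSpace Y] (hp : 1 ≤ p) {T : X →L[𝕜] Y}
    {S : ℕ → X →L[𝕜] Y} {ε : ℕ → ℝ≥0∞} (hS : ∀ i, HasRep p (S i) (ε i)) (hε : ∑' i, ε i ≠ ∞)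
    (hT : ∀ x, Tendsto (fun n => ∑ i ∈ Finset.range n, S i x) atTop (𝓝 (T x))) :
    IsNpOperator p T := by
  choose ι hι x' y hx hy hSx using hS
  obtain ⟨f, hf⟩ := exists_injective_nat (Σ i, ι i)
  set x'' : ℕ → StrongDual 𝕜 X := Function.extend f (fun j => x' j.1 j.2) 0 with hx''
  set y'' : ℕ → Y := Function.extend f (fun j => y j.1 j.2) 0 with hy''
  have hsb : SynthBound 𝕜 p x'' (∑' i, ε i) := (SynthBound.sigma hp hx).extend hp hf
  have hfam : famNorm p y'' ≤ ∑' i, ε i :=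
    (famNorm_extend_le hp _ hf).trans ((famNorm_sigma_le hp y).trans (ENNReal.tsum_le_tsum hy))
  have hyz : StronglySummable p y'' := by
    refine ⟨hfam.trans_lt hε.lt_top, fun _ => ?_⟩
    rw [tendsto_zero_iff_enorm_tendsto_zero, ← Nat.cofinite_eq_atTop, ENNReal.tendsto_nhds_zero]
    intro η hη
    have hfin : {i | ¬ ε i ≤ η}.Finite :=
      ENNReal.tendsto_nhds_zero.1 (ENNReal.tendsto_cofinite_zero_of_tsum_ne_top hε) η hη
    have hfin' : (f '' (Sigma.fst ⁻¹' {i | ¬ ε i ≤ η})).Finite := by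
      refine Set.Finite.image f ?_
      have : Sigma.fst ⁻¹' {i | ¬ ε i ≤ η} ⊆
          ((hfin.toFinset.sigma fun i => (Finset.univ : Finset (ι i))) : Set (Σ i, ι i)) := by
        intro j hj
        simpa using hj
      exact (Finset.finite_toSet _).subset this
    refine hfin'.subset fun k hk => ?_
    by_contra hk'
    apply hk
    by_cases hex : ∃ j, f j = k
    · obtain ⟨j, rfl⟩ := hex
      have hj : ε j.1 ≤ η := by
        by_contra hj
        exact hk' ⟨j, hj, rfl⟩
      simp only [Set.mem_ofPred_eq, hy'', hf.extend_apply]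
      exact (le_famNorm hp (y j.1) j.2).trans ((hy j.1).trans hj)
    · simp [hy'', Function.extend_apply' _ _ _ hex]
  refine ⟨x'', y'', hyz, hsb.iSup_dual_lt_top hp hε, fun x => ?_⟩
  have hs : Summable (fun k => x'' k x • y'' k) :=
    hsb.summable_apply_smul hp hε hyz (inclusionInDoubleDual 𝕜 X x)
  have h1 : HasSum (fun j : Σ i, ι i => x' j.1 j.2 x • y j.1 j.2) (∑' k, x'' k x • y'' k) := by
    have := (hf.hasSum_iff (f := fun k => x'' k x • y'' k) (a := ∑' k, x'' k x • y'' k) (by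
      intro k hk
      simp [hy'', Function.extend_apply' _ _ _ hk])).2 hs.hasSum
    convert this using 2 with j
    simp [hx'', hy'', hf.extend_apply]
  have h2 : HasSum (fun i => S i x) (∑' k, x'' k x • y'' k) := by
    refine h1.sigma fun i => ?_
    rw [hSx i x]
    exact hasSum_fintype _
  rw [tendsto_nhds_unique (hT x) h2.tendsto_sum_nat]
  exact hs.hasSum

/-- Completeness of `N^p`, in the form needed here: let the partial sums `t n` of a representation
of `π_Y T` be approximated by operators `π_Y u` with `u` of finite rank into `Y`, with an
error that has a small finite representation over `Y**`. Then consecutive approximants `u`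
differ by operators with small finite representations over `Y**`, hence over `Y`, and `T` is
the sum of these differences. -/
theorem isNpOperator_of_forall_exists_hasRep [CompleteSpace Y] (hp : 1 ≤ p) {T : X →L[𝕜] Y}
    {t : ℕ → X →L[𝕜] StrongDual 𝕜 (StrongDual 𝕜 Y)}
    (ht : ∀ x, Tendsto (fun n => t n x) atTop (𝓝 (inclusionInDoubleDual 𝕜 Y (T x))))
    (h : ∀ δ : ℝ≥0∞, δ ≠ 0 → δ ≠ ∞ → ∃ u : X →L[𝕜] Y, (∃ M, M ≠ ∞ ∧ HasRep p u M) ∧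
      ∀ᶠ n in atTop, HasRep p (t n - (inclusionInDoubleDual 𝕜 Y).comp u) δ) :
    IsNpOperator p T := by
  set δ : ℕ → ℝ≥0∞ := fun i => 2⁻¹ ^ i with hδ
  have hδ1 : ∀ i, δ i ≤ 1 := fun i => pow_le_one₀ zero_le (by simp)
  have hδsum : ∑' i, δ i = 2 := by
    rw [ENNReal.tsum_geometric, ENNReal.one_sub_inv_two, inv_inv]
  have hδ0 : Tendsto δ atTop (𝓝 0) := by
    rw [← Nat.cofinite_eq_atTop]
    exact ENNReal.tendsto_cofinite_zero_of_tsum_ne_top (by simp [hδsum])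
  choose u hu1 hu2 using fun i => h (δ i) (by simp [hδ]) ((hδ1 i).trans_lt (by simp)).ne
  -- Consecutive approximants are compared through a common partial sum `t n`.
  have hstep : ∀ i, HasRep p (u (i + 1) - u i) (2 * (δ i + δ (i + 1))) := by
    intro i
    apply HasRep.of_bidual hp
    obtain ⟨n, hn1, hn2⟩ := ((hu2 i).and (hu2 (i + 1))).exists
    convert hn1.sub hp hn2 using 1
    ext x g
    simp
  obtain ⟨M, hM, hu0⟩ := hu1 0
  have hlim : ∀ x, Tendsto (fun i => u i x) atTop (𝓝 (T x)) := by
    intro x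
    rw [tendsto_iff_norm_sub_tendsto_zero, tendsto_zero_iff_enorm_tendsto_zero]
    have hb : ∀ i, ‖‖u i x - T x‖‖ₑ ≤ ‖x‖ₑ * δ i := by
      intro i
      have h1 : Tendsto (fun n => ‖t n x - inclusionInDoubleDual 𝕜 Y (u i x)‖ₑ) atTop
          (𝓝 ‖inclusionInDoubleDual 𝕜 Y (T x) - inclusionInDoubleDual 𝕜 Y (u i x)‖ₑ) :=
        ((ht x).sub_const _).enorm
      have h2 := le_of_tendsto h1 ((hu2 i).mono fun n hn => hn.enorm_apply_le hp x)
      rw [← map_sub] at h2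
      have h3 : ‖inclusionInDoubleDual 𝕜 Y (T x - u i x)‖ = ‖T x - u i x‖ :=
        (inclusionInDoubleDualLi 𝕜).norm_map _
      rw [enorm_norm, ← ofReal_norm, norm_sub_rev, ← h3, ofReal_norm]
      refine h2.trans ?_
      calc ‖x‖ₑ * δ i * δ i ≤ ‖x‖ₑ * δ i * 1 := by gcongr; exact hδ1 i
        _ = _ := mul_one _
    have h0 : Tendsto (fun i => ‖x‖ₑ * δ i) atTop (𝓝 0) := by
      simpa using ENNReal.Tendsto.const_mul hδ0 (.inr (by simp : ‖x‖ₑ ≠ ∞))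
    exact tendsto_of_tendsto_of_tendsto_of_le_of_le tendsto_const_nhds h0 (fun _ => zero_le) hb
  set S : ℕ → X →L[𝕜] Y := fun i => Nat.rec (u 0) (fun j _ => u (j + 1) - u j) i with hSdef
  set ε : ℕ → ℝ≥0∞ := fun i => Nat.rec M (fun j _ => 2 * (δ j + δ (j + 1))) i with hεdef
  refine isNpOperator_of_hasRep_sum hp (S := S) (ε := ε) (fun i => ?_) ?_ fun x => ?_
  · cases i with
    | zero => exact hu0
    | succ j => exact hstep j
  · rw [tsum_eq_zero_add' ENNReal.summable]
    have : ∑' j, ε (j + 1) ≤ 8 := by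
      calc ∑' j, ε (j + 1) ≤ ∑' j, 4 * δ j := by
            refine ENNReal.tsum_le_tsum fun j => ?_
            have : δ (j + 1) ≤ δ j := pow_le_pow_right_of_le_one' (by simp) j.le_succ
            calc 2 * (δ j + δ (j + 1)) ≤ 2 * (δ j + δ j) := by gcongr
              _ = 4 * δ j := by ring
        _ = 8 := by rw [ENNReal.tsum_mul_left, hδsum]; norm_num
    exact ENNReal.add_ne_top.2 ⟨hM, (this.trans_lt (by simp)).ne⟩
  · rw [← tendsto_add_atTop_iff_nat 1]
    convert hlim x using 2 with n
    rw [Finset.sum_range_succ']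
    change ∑ j ∈ Finset.range n, (u (j + 1) x - u j x) + u 0 x = u n x
    rw [Finset.sum_range_sub (fun i => u i x), sub_add_cancel]

end Concatenation

/-! ### Hahn–Banach, finite rank operators and compactness -/

section Auxiliary

variable {𝕜 : Type*} [RCLike 𝕜] {ι : Type*}
  {E : Type*} [NormedAddCommGroup E] [NormedSpace 𝕜 E] {p : ℝ≥0∞}

theorem exists_dual_ne_zero_of_notMem_closure {M : Submodule 𝕜 E} {v : E}
    (hv : v ∉ closure (M : Set E)) : ∃ f : StrongDual 𝕜 E, (∀ m ∈ M, f m = 0) ∧ f v ≠ 0 := by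
  set N := M.topologicalClosure
  have : IsClosed (N : Set E) := M.isClosed_topologicalClosure
  have hne : N.mkQ v ≠ 0 := by
    rw [Submodule.mkQ_apply, Ne, Submodule.Quotient.mk_eq_zero]
    exact hv
  obtain ⟨g, -, hg⟩ := exists_dual_vector 𝕜 (N.mkQ v) (norm_ne_zero_iff.2 hne)
  refine ⟨g.comp N.mkQL, fun m hm => ?_, ?_⟩
  · have : N.mkQ m = 0 := by
      rw [Submodule.mkQ_apply, Submodule.Quotient.mk_eq_zero]
      exact M.le_topologicalClosure hm
    change g (N.mkQ m) = 0
    rw [this, map_zero]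
  · change g (N.mkQ v) ≠ 0
    rw [hg]
    exact_mod_cast norm_ne_zero_iff.2 hne

theorem exists_eq_sum_of_finiteDimensional_range {F : E →L[𝕜] E}
    (hF : FiniteDimensional 𝕜 (LinearMap.range (F : E →ₗ[𝕜] E))) :
    ∃ (m : ℕ) (a : Fin m → StrongDual 𝕜 E) (b : Fin m → E), ∀ z, F z = ∑ j, a j z • b j := by
  let B := Module.finBasis 𝕜 (LinearMap.range (F : E →ₗ[𝕜] E))
  refine ⟨_, fun j => (LinearMap.toContinuousLinearMap (B.coord j)).comp
    (F.codRestrict _ fun z => LinearMap.mem_range_self (F : E →ₗ[𝕜] E) z), fun j => B j,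
    fun z => ?_⟩
  have h := congrArg Subtype.val (B.sum_repr ⟨F z, LinearMap.mem_range_self (F : E →ₗ[𝕜] E) z⟩)
  simp only [Submodule.coe_sum, Submodule.coe_smul] at h
  exact h.symm

theorem exists_pos_mul_le {N t : ℝ≥0∞} (hN : N ≠ ∞) (ht : t ≠ 0) :
    ∃ η : ℝ, 0 < η ∧ ENNReal.ofReal η * N ≤ t := by
  have h1 : min t 1 / (N + 1) ≠ ∞ := (ENNReal.div_lt_top (by simp) (by simp)).ne
  have h2 : min t 1 / (N + 1) ≠ 0 :=
    (ENNReal.div_pos (by simp [ht]) (by simp [hN])).ne'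
  refine ⟨(min t 1 / (N + 1)).toReal, ENNReal.toReal_pos h2 h1, ?_⟩
  rw [ENNReal.ofReal_toReal h1]
  calc min t 1 / (N + 1) * N ≤ min t 1 / (N + 1) * (N + 1) := by gcongr; simp
    _ = min t 1 := ENNReal.div_mul_cancel (by simp) (by simp [hN])
    _ ≤ t := min_le_left _ _

/-- By homogeneity it suffices to consider coefficients in the unit ball of `ℓ_p`. -/
theorem synthBound_of_forall_le_one (hp : 1 ≤ p) {x : ι → E} {C : ℝ≥0∞}
    (h : ∀ (s : Finset ι) (c : ι → 𝕜), (∀ k ∉ s, c k = 0) → famNorm p c ≤ 1 →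
      ‖∑ k ∈ s, c k • x k‖ₑ ≤ C) : SynthBound 𝕜 p x C := by
  intro s c hc
  have htop : famNorm p c ≠ ∞ := by
    refine ((famNorm_le_tsum hp c).trans_lt ?_).ne
    rw [tsum_eq_sum (s := s) fun k hk => by simp [hc k hk]]
    exact ENNReal.sum_lt_top.2 fun k _ => by simp
  by_cases h0 : famNorm p c = 0
  · have : ∀ k, c k = 0 := fun k => by
      have := le_famNorm hp c k
      rw [h0] at this
      simpa using this
    simp [this]
  have hr : 0 < (famNorm p c).toReal := ENNReal.toReal_pos h0 htop
  set r : 𝕜 := ((famNorm p c).toReal : 𝕜) with hrdef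
  have hr0 : r ≠ 0 := by
    rw [hrdef]
    exact_mod_cast hr.ne'
  have hrn : ‖r‖ₑ = famNorm p c := by
    rw [← ofReal_norm, RCLike.norm_ofReal, abs_of_pos hr, ENNReal.ofReal_toReal htop]
  have h1 := h s (fun k => r⁻¹ * c k) (fun k hk => by simp [hc k hk]) (by
    refine (famNorm_le_mul hp (famNorm p c)⁻¹ fun k => ?_).trans
      (ENNReal.inv_mul_cancel h0 htop).le
    rw [enorm_mul, enorm_inv hr0, hrn])
  calc ‖∑ k ∈ s, c k • x k‖ₑ = ‖r • ∑ k ∈ s, (r⁻¹ * c k) • x k‖ₑ := by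
        congr 1
        rw [Finset.smul_sum]
        refine Finset.sum_congr rfl fun k _ => ?_
        rw [smul_smul, mul_inv_cancel_left₀ hr0]
    _ = ‖∑ k ∈ s, (r⁻¹ * c k) • x k‖ₑ * famNorm p c := by rw [enorm_smul, hrn, mul_comm]
    _ ≤ _ := by gcongr

/-- Multiplication by a null sequence makes the synthesis operator compact. -/
theorem SynthBound.totallyBounded (hp : 1 ≤ p) {x : ℕ → E} {C : ℝ≥0∞} (h : SynthBound 𝕜 p x C)
    (hC : C ≠ ∞) {l : ℕ → 𝕜} (hl : Tendsto l atTop (𝓝 0)) :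
    TotallyBounded {v : E | ∃ (s : Finset ℕ) (c : ℕ → 𝕜), (∀ k ∉ s, c k = 0) ∧ famNorm p c ≤ 1 ∧
      ∑ k ∈ s, c k • l k • x k = v} := by
  rw [Metric.totallyBounded_iff]
  intro ε hε
  obtain ⟨η, hη, hηC⟩ := exists_pos_mul_le hC (t := ENNReal.ofReal (ε / 4)) (by simpa using hε)
  obtain ⟨n, hn⟩ := Metric.tendsto_atTop.1 hl η hη
  let Φ : (Fin n → 𝕜) → E := fun c => ∑ k, c k • l k • x k
  have hΦ : Continuous Φ := by fun_prop
  obtain ⟨t, ht, htc⟩ := Metric.totallyBounded_iff.1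
    ((isCompact_closedBall (0 : Fin n → 𝕜) 1).image hΦ).totallyBounded (ε / 2) (by positivity)
  refine ⟨t, ht, ?_⟩
  rintro _ ⟨s, c, hc, hc1, rfl⟩
  have hmem : Φ (fun k => c k) ∈ Φ '' Metric.closedBall 0 1 := by
    refine ⟨_, ?_, rfl⟩
    rw [mem_closedBall_zero_iff, pi_norm_le_iff_of_nonneg zero_le_one]
    intro k
    have := (le_famNorm hp c k).trans hc1
    rwa [← ofReal_norm, ENNReal.ofReal_le_one] at this
  obtain ⟨y, hy, hyd⟩ := Set.mem_iUnion₂.1 (htc hmem)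
  refine Set.mem_iUnion₂.2 ⟨y, hy, ?_⟩
  have htail := (h.smul hp (a := (Set.Ici n).indicator l) (L := ENNReal.ofReal η) (fun k => by
    by_cases hk : n ≤ k
    · have := (hn k hk).le
      rw [dist_zero_right] at this
      simp only [Set.indicator, Set.mem_Ici, hk, if_true]
      rw [← ofReal_norm]
      exact ENNReal.ofReal_le_ofReal this
    · simp [Set.indicator, hk])) s c hc
  have hle : ‖∑ k ∈ s, c k • (Set.Ici n).indicator l k • x k‖ ≤ ε / 4 := by
    rw [← ENNReal.ofReal_le_ofReal_iff (by positivity), ofReal_norm]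
    calc _ ≤ _ := htail
      _ ≤ ENNReal.ofReal (ε / 4) * 1 := by gcongr
      _ = _ := mul_one _
  -- Up to the coefficients of index at least `n`, the sum lies in a compact finite-dimensional set.
  have hsplit : ∑ k ∈ s, c k • l k • x k - Φ (fun k => c k)
      = ∑ k ∈ s, c k • (Set.Ici n).indicator l k • x k := by
    have h1 : Φ (fun k => c k) = ∑ k ∈ s, c k • (l k - (Set.Ici n).indicator l k) • x k := by
      simp only [Φ]
      rw [Fin.sum_univ_eq_sum_range (fun k => c k • l k • x k) n]
      have h2 : ∀ k, c k • (l k - (Set.Ici n).indicator l k) • x k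
          = if k ∈ Finset.range n then c k • l k • x k else 0 := by
        intro k
        by_cases hk : n ≤ k
        · simp [Set.indicator, hk]
        · simp [Set.indicator, hk, not_le.1 hk]
      simp_rw [h2]
      rw [Finset.sum_ite_mem, Finset.inter_comm, ← Finset.sum_ite_mem]
      refine Finset.sum_congr rfl fun k _ => ?_
      by_cases hk : k ∈ s
      · simp [hk]
      · simp [hk, hc k hk]
    rw [h1, ← Finset.sum_sub_distrib]
    refine Finset.sum_congr rfl fun k _ => ?_
    rw [← smul_sub, ← sub_smul, sub_sub_cancel]
  rw [Metric.mem_ball] at hyd ⊢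
  calc dist (∑ k ∈ s, c k • l k • x k) y
      ≤ dist (∑ k ∈ s, c k • l k • x k) (Φ fun k => c k) + dist (Φ fun k => c k) y :=
        dist_triangle _ _ _
    _ < ε / 4 + ε / 2 := by
        refine add_lt_add_of_le_of_lt ?_ hyd
        rw [dist_eq_norm, hsplit]
        exact hle
    _ < ε := by linarith

end Auxiliary

/-! ### The approximation property of `X*` -/

section DualAP

variable {𝕜 : Type*} [RCLike 𝕜]
  {X : Type*} [NormedAddCommGroup X] [NormedSpace 𝕜 X]
  {Y : Type*} [NormedAddCommGroup Y] [NormedSpace 𝕜 Y] {p : ℝ≥0∞}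

open NormedSpace

/-- If `π_Y T = ∑ x'_k ⊗ z_k` and `f ∈ Y***` annihilates `Y`, then `∑ f(z_k) x'_k`, the image of
`f` under the adjoint of `π_Y T`, vanishes. -/
theorem hasSum_zero_of_annihilator (hp : 1 ≤ p) {T : X →L[𝕜] Y} {x' : ℕ → StrongDual 𝕜 X}
    {C : ℝ≥0∞} (hx : SynthBound 𝕜 p x' C) (hC : C ≠ ∞)
    {z : ℕ → StrongDual 𝕜 (StrongDual 𝕜 Y)} (hz : StronglySummable p z)
    (hT : ∀ x, HasSum (fun k => x' k x • z k) (inclusionInDoubleDual 𝕜 Y (T x)))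
    {f : StrongDual 𝕜 (StrongDual 𝕜 (StrongDual 𝕜 Y))}
    (hf : ∀ y, f (inclusionInDoubleDual 𝕜 Y y) = 0) :
    HasSum (fun k => f (z k) • x' k) 0 := by
  have hfz : StronglySummable p (fun k => f (z k)) :=
    hz.of_le_mul hp (C := ‖f‖ₑ) (by simp) fun k => f.le_opENorm _
  have hs := (hx.summable_smul hp hC hfz).hasSum
  have h0 : ∑' k, f (z k) • x' k = 0 := by
    refine ContinuousLinearMap.ext fun x => ?_
    have h1 := hasSum_apply hs x
    have h2 := (hT x).mapL f
    rw [hf] at h2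
    change _ = (0 : 𝕜)
    refine h1.unique ?_
    convert h2 using 2 with k
    simp [mul_comm]
  rwa [h0] at hs

/-- If `π_Y T = ∑ x'_k ⊗ z_k`, then the second adjoint `a ↦ ∑ a(x'_k) z_k` takes its values in
`Y`. -/
theorem exists_inclusion_eq_tsum [CompleteSpace Y] (hp : 1 ≤ p) {T : X →L[𝕜] Y}
    {x' : ℕ → StrongDual 𝕜 X} {C : ℝ≥0∞} (hx : SynthBound 𝕜 p x' C) (hC : C ≠ ∞)
    {z : ℕ → StrongDual 𝕜 (StrongDual 𝕜 Y)} (hz : StronglySummable p z)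
    (hT : ∀ x, HasSum (fun k => x' k x • z k) (inclusionInDoubleDual 𝕜 Y (T x)))
    (a : StrongDual 𝕜 (StrongDual 𝕜 X)) :
    ∃ y, inclusionInDoubleDual 𝕜 Y y = ∑' k, a (x' k) • z k := by
  by_contra hnot
  have hclosed : IsClosed (LinearMap.range
      (inclusionInDoubleDual 𝕜 Y : Y →ₗ[𝕜] StrongDual 𝕜 (StrongDual 𝕜 Y)) :
        Set (StrongDual 𝕜 (StrongDual 𝕜 Y))) :=
    (inclusionInDoubleDualLi 𝕜 (E := Y)).isometry.isClosedEmbedding.isClosed_range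
  obtain ⟨f, hf, hfw⟩ := exists_dual_ne_zero_of_notMem_closure (𝕜 := 𝕜)
    (v := ∑' k, a (x' k) • z k) (by rw [hclosed.closure_eq]; exact hnot)
  apply hfw
  have h1 := (hx.summable_apply_smul hp hC hz a).hasSum.mapL f
  have h2 := (hasSum_zero_of_annihilator hp hx hC hz hT
    (fun y => hf _ (LinearMap.mem_range_self _ y))).mapL a
  rw [map_zero] at h2
  refine h1.unique ?_
  convert h2 using 2 with k
  simp [mul_comm]

/-- Let `(w_k)` be `(x'_k)` multiplied by a null sequence, so that the sums `∑ c_k w_k` with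
`‖c‖_p ≤ 1` lie in a compact set. If `F` is a finite rank operator on `X*` close to the identity
on this set, then `∑ F w_k ⊗ z_k` is of finite rank, has values in `Y` by
`exists_inclusion_eq_tsum`, and approximates `∑ w_k ⊗ z_k`. -/
theorem exists_hasRep_of_hasAP_dual [CompleteSpace Y] (hp : 1 ≤ p)
    (hAP : HasAP 𝕜 (StrongDual 𝕜 X)) {T : X →L[𝕜] Y}
    {x' : ℕ → StrongDual 𝕜 X} {C : ℝ≥0∞} (hx : SynthBound 𝕜 p x' C) (hC : C ≠ ∞)
    {y : ℕ → StrongDual 𝕜 (StrongDual 𝕜 Y)} (hy : StronglySummable p y)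
    (hT : ∀ x, HasSum (fun k => x' k x • y k) (inclusionInDoubleDual 𝕜 Y (T x)))
    {δ : ℝ≥0∞} (hδ : δ ≠ 0) (hδ' : δ ≠ ∞) :
    ∃ u : X →L[𝕜] Y, (∃ M, M ≠ ∞ ∧ HasRep p u M) ∧ ∀ᶠ n in atTop,
      HasRep p (∑ k ∈ Finset.range n, (x' k).smulRight (y k) -
        (inclusionInDoubleDual 𝕜 Y).comp u) δ := by
  obtain ⟨l, -, hl0, z, hz, hyz⟩ := hy.exists_null_factor (𝕜 := 𝕜) hp
  have hl𝕜 : Tendsto (fun k => (l k : 𝕜)) atTop (𝓝 0) := by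
    simpa [Function.comp_def] using
      (RCLike.continuous_ofReal (K := 𝕜)).continuousAt.tendsto.comp hl0
  set w : ℕ → StrongDual 𝕜 X := fun k => (l k : 𝕜) • x' k with hw
  obtain ⟨L, hL, hlL⟩ : ∃ L : ℝ≥0∞, L ≠ ∞ ∧ ∀ k, ‖(l k : 𝕜)‖ₑ ≤ L :=
    ⟨_, (stronglySummable_top_of_tendsto hl𝕜).1.ne, le_famNorm (p := ∞) le_top _⟩
  have hwsb : SynthBound 𝕜 p w (L * C) := hx.smul hp hlL
  have hLC : L * C ≠ ∞ := ENNReal.mul_ne_top hL hC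
  have hwy : ∀ x k, w k x • z k = x' k x • y k := by
    intro x k
    change ((l k : 𝕜) * x' k x) • z k = _
    rw [hyz k, smul_smul, mul_comm]
  have hTw : ∀ x, HasSum (fun k => w k x • z k) (inclusionInDoubleDual 𝕜 Y (T x)) := by
    intro x
    simp_rw [hwy]
    exact hT x
  have hδ2 : δ / 2 ≠ 0 := (ENNReal.half_pos hδ).ne'
  have hδ2' : δ / 2 ≠ ∞ := (ENNReal.div_lt_top hδ' (by simp)).ne
  have hδδ : δ / 2 * (δ / 2) ≠ 0 := mul_ne_zero hδ2 hδ2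
  obtain ⟨η, hη, hηN⟩ := exists_pos_mul_le (N := famNorm p z) hz.1.ne hδδ
  set K := {v : StrongDual 𝕜 X | ∃ (s : Finset ℕ) (c : ℕ → 𝕜), (∀ k ∉ s, c k = 0) ∧
    famNorm p c ≤ 1 ∧ ∑ k ∈ s, c k • (l k : 𝕜) • x' k = v} with hK
  have hKc : IsCompact (closure K) :=
    (TotallyBounded.closure (hx.totallyBounded hp hC hl𝕜)).isCompact_of_isClosed isClosed_closure
  obtain ⟨F, hF, hFK⟩ := hAP _ hKc η hη
  obtain ⟨m, a, b, hab⟩ := exists_eq_sum_of_finiteDimensional_range hF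
  have hsbF : SynthBound 𝕜 p (fun k => w k - F (w k)) (ENNReal.ofReal η) := by
    refine synthBound_of_forall_le_one hp fun s c hc hc1 => ?_
    have h1 := hFK (∑ k ∈ s, c k • w k) (subset_closure ⟨s, c, hc, hc1, rfl⟩)
    have h2 : ∑ k ∈ s, c k • (w k - F (w k)) = ∑ k ∈ s, c k • w k - F (∑ k ∈ s, c k • w k) := by
      simp [smul_sub]
    rw [h2, ← ofReal_norm, norm_sub_rev]
    exact ENNReal.ofReal_le_ofReal h1
  choose v hv using fun j => exists_inclusion_eq_tsum hp hwsb hLC hz hTw (a j)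
  set u : X →L[𝕜] Y := ∑ j, (b j).smulRight (v j) with hu
  have hux : ∀ x, u x = ∑ j, b j x • v j := fun x => by simp [hu]
  refine ⟨u, hasRep_of_finite hp hux, ?_⟩
  -- The remainders of the series for the vectors of `u`; they make up for truncating `t` at `n`.
  set e : ℕ → Fin m → StrongDual 𝕜 (StrongDual 𝕜 Y) := fun n j =>
    inclusionInDoubleDual 𝕜 Y (v j) - ∑ k ∈ Finset.range n, a j (w k) • z k with he
  have he0 : Tendsto (fun n => ∑ j, ‖e n j‖ₑ) atTop (𝓝 0) := by
    have : ∀ j, Tendsto (fun n => ‖e n j‖ₑ) atTop (𝓝 0) := by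
      intro j
      have h1 := (hwsb.summable_apply_smul hp hLC hz (a j)).hasSum.tendsto_sum_nat
      rw [← hv j] at h1
      simpa using (h1.const_sub (inclusionInDoubleDual 𝕜 Y (v j))).enorm
    simpa using tendsto_finsetSum Finset.univ fun j _ => this j
  have hB : ∑' j, ‖b j‖ₑ ≠ ∞ := by simp [tsum_fintype, ENNReal.sum_eq_top]
  obtain ⟨θ, hθ, hθB⟩ := exists_pos_mul_le hB hδδ
  filter_upwards [he0.eventually (eventually_le_nhds (ENNReal.ofReal_pos.2 hθ))] with n hn
  have h1 : HasRep p (∑ k ∈ Finset.range n, (w k - F (w k)).smulRight (z k)) (δ / 2) := by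
    refine hasRep_of_mul_le hp (ι := Fin n) (x' := fun k => w k - F (w k)) (y := fun k => z k)
      (hsbF.comp_injective hp Fin.val_injective) (famNorm_comp_le hp z Fin.val_injective)
      ENNReal.ofReal_ne_top hz.1.ne hδ2 hδ2' hηN fun x => ?_
    rw [Fin.sum_univ_eq_sum_range (fun k => (w k - F (w k)) x • z k) n]
    simp
  have h2 : HasRep p (∑ j, (b j).smulRight (e n j)) (δ / 2) := by
    refine hasRep_of_mul_le hp (ι := Fin m) (x' := b) (y := e n)
      (synthBound_tsum_enorm hp b) ((famNorm_le_tsum hp _).trans ((tsum_fintype _).le.trans hn))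
      hB ENNReal.ofReal_ne_top hδ2 hδ2' (by rwa [mul_comm]) fun x => by simp
  convert h1.sub hp h2 using 1
  · refine ContinuousLinearMap.ext fun x => ?_
    have hFx : ∀ k, (F (w k)) x = ∑ j, a j (w k) * b j x := by
      intro k
      rw [hab (w k)]
      simp
    simp only [_root_.sub_apply, _root_.sum_apply, ContinuousLinearMap.smulRight_apply,
      ContinuousLinearMap.comp_apply, hux, map_sum, map_smul, he, hFx, sub_smul, smul_sub,
      Finset.sum_sub_distrib, hwy]
    have h3 : ∑ k ∈ Finset.range n, (∑ j, a j (w k) * b j x) • z k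
        = ∑ j, b j x • ∑ k ∈ Finset.range n, a j (w k) • z k := by
      simp only [Finset.sum_smul, Finset.smul_sum, smul_smul]
      rw [Finset.sum_comm]
      simp only [mul_comm]
    rw [h3]
    abel
  · exact (ENNReal.add_halves δ).symm

end DualAP

/-! ### Functionals on the space of null sequences -/

section NullSequences

open scoped ZeroAtInfty

variable {𝕜 : Type*} [RCLike 𝕜] {E : Type*} [NormedAddCommGroup E] [NormedSpace 𝕜 E]

/-- A null sequence as an element of `C₀(ℕ, E)`. -/
def nullSeq (v : ℕ → E) (hv : Tendsto v atTop (𝓝 0)) : C₀(ℕ, E) where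
  toFun := v
  continuous_toFun := continuous_of_discreteTopology
  zero_at_infty' := by rwa [cocompact_eq_cofinite, Nat.cofinite_eq_atTop]

theorem norm_le_of_forall_apply_le (u : C₀(ℕ, E)) {r : ℝ} (hr : 0 ≤ r) (h : ∀ k, ‖u k‖ ≤ r) :
    ‖u‖ ≤ r :=
  (BoundedContinuousFunction.norm_le (f := u.toBCF) hr).2 h

theorem norm_apply_le_norm (u : C₀(ℕ, E)) (k : ℕ) : ‖u k‖ ≤ ‖u‖ :=
  u.toBCF.norm_coe_le_norm k

theorem tendsto_nullSeq (u : C₀(ℕ, E)) : Tendsto u atTop (𝓝 0) := by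
  have := u.zero_at_infty'
  rwa [cocompact_eq_cofinite, Nat.cofinite_eq_atTop] at this

theorem tendsto_pi_single (k : ℕ) (z : E) :
    Tendsto (Pi.single k z : ℕ → E) atTop (𝓝 0) := by
  refine tendsto_const_nhds.congr' ?_
  filter_upwards [eventually_gt_atTop k] with j hj
  rw [Pi.single_eq_of_ne hj.ne']

variable (𝕜 E) in
/-- The embedding of `E` into `C₀(ℕ, E)` as the `k`-th coordinate. -/
def singleC0 (k : ℕ) : E →L[𝕜] C₀(ℕ, E) :=
  LinearMap.mkContinuous
    { toFun := fun z => nullSeq (Pi.single k z) (tendsto_pi_single k z)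
      map_add' := fun z w => by
        ext j; exact congrFun (Pi.single_add (f := fun _ : ℕ => E) k z w) j
      map_smul' := fun a z => by
        ext j; exact congrFun (Pi.single_smul (f := fun _ : ℕ => E) k a z) j } 1
    fun z => by
      rw [one_mul]
      refine norm_le_of_forall_apply_le _ (norm_nonneg z) fun j => ?_
      change ‖(Pi.single k z : ℕ → E) j‖ ≤ ‖z‖
      by_cases hj : j = k
      · subst hj; simp
      · simp [Pi.single_eq_of_ne hj]

theorem singleC0_apply (k : ℕ) (z : E) (j : ℕ) :
    singleC0 𝕜 E k z j = (Pi.single k z : ℕ → E) j := rfl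

theorem sum_singleC0_apply (s : Finset ℕ) (z : ℕ → E) (j : ℕ) :
    (∑ k ∈ s, singleC0 𝕜 E k (z k)) j = if j ∈ s then z j else 0 := by
  classical
  have h : (∑ k ∈ s, singleC0 𝕜 E k (z k)) j = ∑ k ∈ s, singleC0 𝕜 E k (z k) j := by
    induction s using Finset.induction_on with
    | empty => simp
    | insert a s ha ih => rw [Finset.sum_insert ha, Finset.sum_insert ha,
        ZeroAtInftyContinuousMap.add_apply, ih]
  rw [h]
  simp [singleC0_apply, Pi.single_apply]

theorem hasSum_singleC0 (u : C₀(ℕ, E)) : HasSum (fun k => singleC0 𝕜 E k (u k)) u := by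
  rw [HasSum, SummationFilter.unconditional_filter, Metric.tendsto_atTop]
  intro ε hε
  obtain ⟨n, hn⟩ := Metric.tendsto_atTop.1 (tendsto_nullSeq u) (ε / 2) (half_pos hε)
  refine ⟨Finset.range n, fun s hs => ?_⟩
  rw [dist_eq_norm]
  refine (norm_le_of_forall_apply_le _ (half_pos hε).le fun j => ?_).trans_lt (half_lt_self hε)
  rw [ZeroAtInftyContinuousMap.sub_apply, sum_singleC0_apply]
  by_cases hj : j ∈ s
  · simp [hj, (half_pos hε).le]
  · have : n ≤ j := by
      by_contra hlt
      exact hj (hs (by simpa using hlt))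
    simpa [hj] using (hn j this).le

/-- The coordinates of a functional on `c₀(E)` are absolutely summable. -/
theorem summable_norm_comp_singleC0 (φ : StrongDual 𝕜 C₀(ℕ, E)) :
    Summable fun k => ‖φ.comp (singleC0 𝕜 E k)‖ := by
  refine summable_of_sum_le (c := ‖φ‖ * 2) (fun _ => norm_nonneg _) fun s => ?_
  choose z hz1 hz2 using fun k => exists_norm_lt_two_norm_le_re (φ.comp (singleC0 𝕜 E k))
  calc ∑ k ∈ s, ‖φ.comp (singleC0 𝕜 E k)‖
      ≤ ∑ k ∈ s, RCLike.re (φ (singleC0 𝕜 E k (z k))) := Finset.sum_le_sum fun k _ => hz2 k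
    _ = RCLike.re (φ (∑ k ∈ s, singleC0 𝕜 E k (z k))) := by rw [map_sum, map_sum]
    _ ≤ ‖φ (∑ k ∈ s, singleC0 𝕜 E k (z k))‖ := RCLike.re_le_norm _
    _ ≤ ‖φ‖ * ‖∑ k ∈ s, singleC0 𝕜 E k (z k)‖ := φ.le_opNorm _
    _ ≤ ‖φ‖ * 2 := by
        gcongr
        refine norm_le_of_forall_apply_le _ zero_le_two fun j => ?_
        rw [sum_singleC0_apply]
        split_ifs
        · exact (hz1 j).le
        · simp

end NullSequences

/-! ### The trace argument in a dual with the approximation property -/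

section TripleDualAP

open NormedSpace
open scoped ZeroAtInfty

variable {𝕜 : Type*} [RCLike 𝕜] {Y : Type*} [NormedAddCommGroup Y] [NormedSpace 𝕜 Y]

variable (𝕜 Y) in
/-- The projection `id - π_{Y*} (π_Y)*` of `Y***` onto the annihilator of `Y`. -/
def projAnnihilator : StrongDual 𝕜 (StrongDual 𝕜 (StrongDual 𝕜 Y)) →L[𝕜]
    StrongDual 𝕜 (StrongDual 𝕜 (StrongDual 𝕜 Y)) :=
  ContinuousLinearMap.id 𝕜 _ - (inclusionInDoubleDual 𝕜 (StrongDual 𝕜 Y)).comp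
    (ContinuousLinearMap.precomp 𝕜 (inclusionInDoubleDual 𝕜 Y))

theorem projAnnihilator_apply_inclusion (f : StrongDual 𝕜 (StrongDual 𝕜 (StrongDual 𝕜 Y))) (y : Y) :
    projAnnihilator 𝕜 Y f (inclusionInDoubleDual 𝕜 Y y) = 0 := by
  simp [projAnnihilator]

theorem projAnnihilator_eq_self {f : StrongDual 𝕜 (StrongDual 𝕜 (StrongDual 𝕜 Y))}
    (hf : ∀ y, f (inclusionInDoubleDual 𝕜 Y y) = 0) : projAnnihilator 𝕜 Y f = f := by
  have : ContinuousLinearMap.precomp 𝕜 (inclusionInDoubleDual 𝕜 Y) f = 0 :=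
    ContinuousLinearMap.ext hf
  simp [projAnnihilator, this]

/-- The span of the sequences `(h(v_k) ζ)_k`, with `ζ ∈ E` and `h` in the annihilator of `N`; that
is, the sequences `(H v_k)_k` for `H` of finite rank on `E` and zero on `N`. -/
def annihilatorSpan {E : Type*} [NormedAddCommGroup E] [NormedSpace 𝕜 E] (N : Submodule 𝕜 E)
    (v : ℕ → E) : Submodule 𝕜 (ℕ → E) :=
  Submodule.span 𝕜 {D | ∃ h : StrongDual 𝕜 E, (∀ y ∈ N, h y = 0) ∧ ∃ ζ : E,
    D = fun k => h (v k) • ζ}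

/-- If the nuclear operator `∑ e_k ⊗ φ_k` vanishes on the range of a projection `P` of `Z` that
fixes all `φ_k`, and `Z` has the approximation property, then the trace `∑ e_k(φ_k)` vanishes:
it is the limit of the traces of `P F (∑ e_k ⊗ φ_k)` with `F` of finite rank, and these
vanish. -/
theorem eq_zero_of_hasSum_trace {Z : Type*} [NormedAddCommGroup Z] [NormedSpace 𝕜 Z]
    (hAP : HasAP 𝕜 Z) (P : Z →L[𝕜] Z) {e : ℕ → StrongDual 𝕜 Z} {V : ℝ} (hV : ∀ k, ‖e k‖ ≤ V)
    {φ : ℕ → Z} (hφ : Summable fun k => ‖φ k‖) (hPφ : ∀ k, P (φ k) = φ k)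
    (hzero : ∀ z, HasSum (fun k => e k (P z) • φ k) 0)
    {τ : 𝕜} (hτ : HasSum (fun k => e k (φ k)) τ) : τ = 0 := by
  have hφ1 : StronglySummable 1 φ :=
    stronglySummable_of_summable le_rfl ENNReal.one_ne_top (by simpa using hφ)
  obtain ⟨m, ψ, hm, hψ, hφψ⟩ := hφ1.exists_eq_smul_null (𝕜 := 𝕜) le_rfl
  have hm' : Summable fun k => ‖m k‖ := by
    simpa using hm.summable le_rfl ENNReal.one_ne_top
  have key : ∀ η : ℝ, 0 < η → ‖τ‖ ≤ η * (V * ‖P‖ * ∑' k, ‖m k‖) := by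
    intro η hη
    obtain ⟨F, hF, hFψ⟩ := hAP _ hψ.isCompact_insert_range η hη
    obtain ⟨N, a, b, hab⟩ := exists_eq_sum_of_finiteDimensional_range hF
    have h1 : HasSum (fun k => e k (P (F (φ k)))) 0 := by
      have h2 : ∀ j ∈ Finset.univ, HasSum (fun k => a j (e k (P (b j)) • φ k)) 0 := fun j _ => by
        simpa using (hzero (b j)).mapL (a j)
      have h3 := hasSum_sum h2
      rw [Finset.sum_const_zero] at h3
      convert h3 using 2 with k
      rw [hab]
      simp [mul_comm]
    have h4 := hτ.sub h1
    rw [sub_zero] at h4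
    have h5 : ∀ k, ‖e k (φ k) - e k (P (F (φ k)))‖ ≤ η * (V * ‖P‖) * ‖m k‖ := by
      intro k
      have h6 : e k (φ k) - e k (P (F (φ k))) = -(m k * e k (P (F (ψ k) - ψ k))) := by
        have e1 : e k (φ k) = m k * e k (P (ψ k)) := by
          rw [← hPφ k, hφψ k, map_smul, map_smul, smul_eq_mul]
        have e2 : e k (P (F (φ k))) = m k * e k (P (F (ψ k))) := by
          rw [hφψ k, map_smul, map_smul, map_smul, smul_eq_mul]
        rw [e1, e2, map_sub, map_sub]
        ring
      rw [h6, norm_neg, norm_mul, mul_comm]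
      gcongr
      calc ‖e k (P (F (ψ k) - ψ k))‖ ≤ ‖e k‖ * ‖P (F (ψ k) - ψ k)‖ := (e k).le_opNorm _
        _ ≤ V * (‖P‖ * η) := by
            gcongr
            · exact (norm_nonneg _).trans (hV k)
            · exact hV k
            · exact (P.le_opNorm _).trans (by
                gcongr
                exact hFψ _ (Set.mem_insert_of_mem _ ⟨k, rfl⟩))
        _ = η * (V * ‖P‖) := by ring
    have h8 := tsum_of_norm_bounded (hm'.hasSum.mul_left (η * (V * ‖P‖))) h5
    rw [h4.tsum_eq] at h8
    linarith
  rw [← norm_le_zero_iff]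
  set R := V * ‖P‖ * ∑' k, ‖m k‖ with hR
  have hlim : Tendsto (fun η : ℝ => η * R) (𝓝[>] 0) (𝓝 (0 * R)) :=
    ((continuous_id.mul continuous_const).tendsto 0).mono_left nhdsWithin_le_nhds
  rw [zero_mul] at hlim
  exact ge_of_tendsto hlim (by filter_upwards [self_mem_nhdsWithin] with η hη using key η hη)

/-- If `E*` has the approximation property and the annihilator of `N` is complemented in `E*`,
then a null sequence in `E` is, up to a uniformly small error, the sum of a bounded sequence
in `N` and a sequence in `annihilatorSpan`. Otherwise a functional `(φ_k)` on `c₀(E)`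
separates the null sequence `v` from these sequences, and `∑ φ_k(v_k)` would be the nonzero
trace of a nuclear operator that vanishes on the annihilator of `N`. -/
theorem exists_approx_modulo_annihilatorSpan {E : Type*} [NormedAddCommGroup E] [NormedSpace 𝕜 E]
    (hAP : HasAP 𝕜 (StrongDual 𝕜 E)) {N : Submodule 𝕜 E}
    (P : StrongDual 𝕜 E →L[𝕜] StrongDual 𝕜 E) (hPN : ∀ h, ∀ y ∈ N, P h y = 0)
    (hP : ∀ h : StrongDual 𝕜 E, (∀ y ∈ N, h y = 0) → P h = h)
    {v : ℕ → E} (hv : Tendsto v atTop (𝓝 0)) {ε : ℝ} (hε : 0 < ε) :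
    ∃ (y : ℕ → E) (B : ℝ) (D : ℕ → E), (∀ k, y k ∈ N) ∧ (∀ k, ‖y k‖ ≤ B) ∧
      D ∈ annihilatorSpan N v ∧ ∀ k, ‖v k - y k - D k‖ ≤ ε := by
  let M₁ : Submodule 𝕜 C₀(ℕ, E) :=
    { carrier := {w | ∀ k, w k ∈ N}
      add_mem' := fun hw hw' k => N.add_mem (hw k) (hw' k)
      zero_mem' := fun _ => N.zero_mem
      smul_mem' := fun c _ hw k => N.smul_mem c (hw k) }
  let coeL : C₀(ℕ, E) →ₗ[𝕜] (ℕ → E) :=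
    { toFun := fun w => w
      map_add' := fun _ _ => rfl
      map_smul' := fun _ _ => rfl }
  let M₂ := (annihilatorSpan N v).comap coeL
  set w := nullSeq v hv with hw
  have hmem : w ∈ closure ((M₁ ⊔ M₂ : Submodule 𝕜 _) : Set C₀(ℕ, E)) := by
    by_contra hnot
    obtain ⟨f, hf, hfw⟩ := exists_dual_ne_zero_of_notMem_closure hnot
    apply hfw
    set φ : ℕ → StrongDual 𝕜 E := fun k => f.comp (singleC0 𝕜 E k) with hφdef
    have hφ : Summable fun k => ‖φ k‖ := summable_norm_comp_singleC0 f
    have hrep : ∀ u : C₀(ℕ, E), HasSum (fun k => φ k (u k)) (f u) :=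
      fun u => (hasSum_singleC0 u).mapL f
    refine eq_zero_of_hasSum_trace hAP P (e := fun k => inclusionInDoubleDual 𝕜 E (v k))
      (fun k => (double_dual_bound 𝕜 _ (v k)).trans (norm_apply_le_norm w k)) hφ
      (fun k => hP _ fun y hy => ?_) (fun h => ?_) (hrep w)
    · refine hf _ (Submodule.mem_sup_left fun j => ?_)
      change (Pi.single k y : ℕ → E) j ∈ N
      by_cases hj : j = k
      · subst hj
        rwa [Pi.single_eq_same]
      · rw [Pi.single_eq_of_ne hj]
        exact N.zero_mem
    · have hs : Summable fun k => P h (v k) • φ k := by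
        refine Summable.of_norm_bounded (g := fun k => ‖P h‖ * ‖w‖ * ‖φ k‖) (hφ.mul_left _)
          fun k => ?_
        rw [norm_smul]
        gcongr
        exact ((P h).le_opNorm _).trans (by gcongr; exact norm_apply_le_norm w k)
      have h0 : ∑' k, P h (v k) • φ k = 0 := by
        refine ContinuousLinearMap.ext fun ζ => ?_
        change _ = (0 : 𝕜)
        have hD0 : Tendsto (fun k => P h (v k) • ζ) atTop (𝓝 0) := by
          have : Tendsto (fun k => P h (v k)) atTop (𝓝 0) := by
            simpa [Function.comp_def] using ((P h).continuous.tendsto 0).comp hv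
          simpa using this.smul_const ζ
        have hD := hf (nullSeq _ hD0) (Submodule.mem_sup_right
          (Submodule.subset_span ⟨P h, hPN h, ζ, rfl⟩))
        have h1 := hrep (nullSeq _ hD0)
        rw [hD] at h1
        refine (hasSum_apply hs.hasSum ζ).unique ?_
        convert h1 using 2 with k
        change _ = φ k (P h (v k) • ζ)
        simp
      have hsum := hs.hasSum
      rw [h0] at hsum
      exact hsum
  obtain ⟨z, hz, hzd⟩ := Metric.mem_closure_iff.1 hmem ε hε
  obtain ⟨q, hq, D, hD, rfl⟩ := Submodule.mem_sup.1 hz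
  refine ⟨q, ‖q‖, D, hq, norm_apply_le_norm q, hD, fun k => ?_⟩
  rw [dist_eq_norm] at hzd
  rw [sub_sub]
  exact (norm_apply_le_norm (w - (q + D)) k).trans hzd.le

end TripleDualAP

/-! ### The approximation property of `Y***` -/

section TripleDualRep

variable {𝕜 : Type*} [RCLike 𝕜]
  {X : Type*} [NormedAddCommGroup X] [NormedSpace 𝕜 X]
  {Y : Type*} [NormedAddCommGroup Y] [NormedSpace 𝕜 Y] {p : ℝ≥0∞}

open NormedSpace

theorem hasRep_zero (hp : 1 ≤ p) (ε : ℝ≥0∞) : HasRep p (0 : X →L[𝕜] Y) ε :=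
  ⟨Empty, inferInstance, Empty.elim, Empty.elim,
    (synthBound_tsum_enorm hp _).mono (by simp), (famNorm_le_tsum hp _).trans (by simp),
    fun x => by simp⟩

theorem HasRep.smul (hp : 1 ≤ p) {S : X →L[𝕜] Y} {ε δ : ℝ≥0∞} (h : HasRep p S ε) (a : 𝕜)
    (hε : ε ≠ ∞) (hδ : δ ≠ 0) (hδ' : δ ≠ ∞) (hle : ε * (‖a‖ₑ * ε) ≤ δ * δ) :
    HasRep p (a • S) δ := by
  obtain ⟨ι, _, x', y, hx, hy, hS⟩ := h
  refine hasRep_of_mul_le hp (x' := x') (y := fun i => a • y i) hx (B := ‖a‖ₑ * ε)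
    ((famNorm_le_mul hp ‖a‖ₑ fun k => (enorm_smul _ _).le).trans (by gcongr)) hε
    (ENNReal.mul_ne_top (by simp) hε) hδ hδ' hle fun x => ?_
  simp only [_root_.smul_apply, hS, Finset.smul_sum]
  exact Finset.sum_congr rfl fun i _ => smul_comm _ _ _

/-- The sequences in `annihilatorSpan` do not contribute to the tensor `∑ x'_k ⊗ m_k v_k`: the
partial sums of `∑ x'_k ⊗ h(m_k v_k) ζ = (∑ h(m_k v_k) x'_k) ⊗ ζ` tend to zero. -/
theorem eventually_hasRep_of_mem_annihilatorSpan (hp : 1 ≤ p) {N : Submodule 𝕜 Y} {v : ℕ → Y}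
    {x' : ℕ → StrongDual 𝕜 X} {m : ℕ → 𝕜}
    (hzero : ∀ h : StrongDual 𝕜 Y, (∀ y ∈ N, h y = 0) → HasSum (fun k => h (m k • v k) • x' k) 0)
    {D : ℕ → Y} (hD : D ∈ annihilatorSpan N v) :
    ∀ δ : ℝ≥0∞, δ ≠ 0 → δ ≠ ∞ → ∀ᶠ n in atTop,
      HasRep p (∑ k ∈ Finset.range n, (x' k).smulRight (m k • D k)) δ := by
  induction hD using Submodule.span_induction with
  | mem D hD =>
    obtain ⟨h, hh, ζ, rfl⟩ := hD
    intro δ hδ hδ'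
    have h1 : Tendsto (fun n => ‖∑ k ∈ Finset.range n, h (m k • v k) • x' k‖ₑ * ‖ζ‖ₑ) atTop
        (𝓝 0) := by
      have := (hzero h hh).tendsto_sum_nat.enorm
      rw [enorm_zero] at this
      simpa using ENNReal.Tendsto.mul_const this (.inr (by simp : ‖ζ‖ₑ ≠ ∞))
    filter_upwards [h1.eventually (eventually_le_nhds
      (pos_iff_ne_zero.2 (mul_ne_zero hδ hδ)))] with n hn
    refine hasRep_of_mul_le hp (ι := Unit)
      (x' := fun _ => ∑ k ∈ Finset.range n, h (m k • v k) • x' k) (y := fun _ => ζ)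
      (synthBound_tsum_enorm hp _) (famNorm_le_tsum hp _) (by simp) (by simp) hδ hδ'
      (by simpa only [tsum_fintype, Finset.univ_unique, Finset.sum_singleton] using hn)
      fun x => ?_
    simp [Finset.sum_smul, smul_smul, mul_comm, mul_left_comm]
  | zero =>
    intro δ _ _
    simp [hasRep_zero hp]
  | add D D' _ _ hD hD' =>
    intro δ hδ hδ'
    have h2 : δ / 2 ≠ 0 := (ENNReal.half_pos hδ).ne'
    have h2' : δ / 2 ≠ ∞ := (ENNReal.div_lt_top hδ' (by simp)).ne
    filter_upwards [hD _ h2 h2', hD' _ h2 h2'] with n hn hn'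
    convert hn.add hp hn' using 1
    · rw [← Finset.sum_add_distrib]
      refine Finset.sum_congr rfl fun k _ => ?_
      ext x
      simp
    · exact (ENNReal.add_halves δ).symm
  | smul a D _ hD =>
    intro δ hδ hδ'
    obtain ⟨η, hη, hηa⟩ := exists_pos_mul_le (N := ‖a‖ₑ) (by simp) hδ
    have hmin : min (ENNReal.ofReal η) δ ≠ 0 :=
      (lt_min (ENNReal.ofReal_pos.2 hη) (pos_iff_ne_zero.2 hδ)).ne'
    have hmin' : min (ENNReal.ofReal η) δ ≠ ∞ :=
      ((min_le_right _ _).trans_lt hδ'.lt_top).ne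
    filter_upwards [hD _ hmin hmin'] with n hn
    convert hn.smul hp a hmin' hδ hδ' ?_ using 1
    · rw [Finset.smul_sum]
      refine Finset.sum_congr rfl fun k _ => ?_
      ext x
      simp only [ContinuousLinearMap.smulRight_apply, Pi.smul_apply, _root_.smul_apply, smul_smul]
      congr 1
      ring
    · calc min (ENNReal.ofReal η) δ * (‖a‖ₑ * min (ENNReal.ofReal η) δ)
          ≤ δ * (‖a‖ₑ * ENNReal.ofReal η) := by
            gcongr
            · exact min_le_right _ _
            · exact min_le_left _ _
        _ ≤ δ * δ := by
            rw [mul_comm ‖a‖ₑ]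
            gcongr

/-- Write `y_k = m_k v_k` with a null sequence `(v_k)` in `Y**` and approximate `(v_k)` by `(q_k +
D_k)`, with `q_k ∈ Y` and `D` in `annihilatorSpan`. The approximant is a partial sum of `∑
x'_k ⊗ m_k q_k`. -/
theorem exists_hasRep_of_hasAP_tripleDual (hp : 1 ≤ p)
    (hAP : HasAP 𝕜 (StrongDual 𝕜 (StrongDual 𝕜 (StrongDual 𝕜 Y)))) {T : X →L[𝕜] Y}
    {x' : ℕ → StrongDual 𝕜 X} {C : ℝ≥0∞} (hx : SynthBound 𝕜 p x' C) (hC : C ≠ ∞)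
    {y : ℕ → StrongDual 𝕜 (StrongDual 𝕜 Y)} (hy : StronglySummable p y)
    (hT : ∀ x, HasSum (fun k => x' k x • y k) (inclusionInDoubleDual 𝕜 Y (T x)))
    {δ : ℝ≥0∞} (hδ : δ ≠ 0) (hδ' : δ ≠ ∞) :
    ∃ u : X →L[𝕜] Y, (∃ M, M ≠ ∞ ∧ HasRep p u M) ∧ ∀ᶠ n in atTop,
      HasRep p (∑ k ∈ Finset.range n, (x' k).smulRight (y k) -
        (inclusionInDoubleDual 𝕜 Y).comp u) δ := by
  obtain ⟨m, v, hm, hv, hmv⟩ := hy.exists_eq_smul_null (𝕜 := 𝕜) hp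
  set N : Submodule 𝕜 (StrongDual 𝕜 (StrongDual 𝕜 Y)) :=
    LinearMap.range (inclusionInDoubleDual 𝕜 Y : Y →ₗ[𝕜] StrongDual 𝕜 (StrongDual 𝕜 Y)) with hN
  have h2 : δ / 2 ≠ 0 := (ENNReal.half_pos hδ).ne'
  have h2' : δ / 2 ≠ ∞ := (ENNReal.div_lt_top hδ' (by simp)).ne
  have h4 : δ / 2 / 2 ≠ 0 := (ENNReal.half_pos h2).ne'
  have h4' : δ / 2 / 2 ≠ ∞ := (ENNReal.div_lt_top h2' (by simp)).ne
  obtain ⟨η, hη, hηC⟩ := exists_pos_mul_le (ENNReal.mul_ne_top hC hm.1.ne) (mul_ne_zero h4 h4)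
  obtain ⟨q, B, D, hqN, hqB, hD, hqD⟩ := exists_approx_modulo_annihilatorSpan hAP (N := N)
    (projAnnihilator 𝕜 Y)
    (by rintro h _ ⟨z, rfl⟩; exact projAnnihilator_apply_inclusion h z)
    (fun h hh => projAnnihilator_eq_self fun z => hh _ ⟨z, rfl⟩) hv hη
  choose z hz using hqN
  have hDrep := eventually_hasRep_of_mem_annihilatorSpan (p := p) hp (x' := x') (m := m)
    (fun h hh => by
      have := hasSum_zero_of_annihilator hp hx hC hy hT (f := h) fun z => hh _ ⟨z, rfl⟩
      simpa only [hmv] using this) hD (δ / 2 / 2) h4 h4'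
  set s : ℕ → StrongDual 𝕜 (StrongDual 𝕜 Y) := fun k => m k • q k with hs
  have hss : StronglySummable p s := by
    refine hm.of_le_mul hp (C := ENNReal.ofReal B) ENNReal.ofReal_ne_top fun k => ?_
    rw [hs, enorm_smul, mul_comm]
    gcongr
    rw [← ofReal_norm]
    exact ENNReal.ofReal_le_ofReal (hqB k)
  obtain ⟨θ, hθ, hθC⟩ := exists_pos_mul_le hC (mul_ne_zero h2 h2)
  obtain ⟨n₀, hn₀⟩ := exists_famNorm_tail_le hp hss (ENNReal.ofReal_pos.2 hθ)
  set u : X →L[𝕜] Y := ∑ k : Fin n₀, (x' k).smulRight (m k • z k) with hu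
  have hux : ∀ x, u x = ∑ k : Fin n₀, x' k x • m k • z k := fun x => by simp [hu]
  refine ⟨u, hasRep_of_finite hp (x' := fun k : Fin n₀ => x' k) (y := fun k => m k • z k) hux, ?_⟩
  filter_upwards [hDrep, eventually_ge_atTop n₀] with n hn hnn
  -- The error consists of three parts: the approximation error of `v`, the contribution of `D`, and
  -- the part of `∑ x'_k ⊗ m_k q_k` with indices from `n₀` to `n`.
  have hr : HasRep p (∑ k ∈ Finset.range n, (x' k).smulRight (m k • (v k - q k - D k)))
      (δ / 2 / 2) := by
    refine hasRep_of_mul_le hp (ι := Fin n) (x' := fun k => x' k)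
      (y := fun k => m k • (v k - q k - D k)) (B := ENNReal.ofReal η * famNorm p m)
      (hx.comp_injective hp Fin.val_injective) ?_ hC
      (ENNReal.mul_ne_top ENNReal.ofReal_ne_top hm.1.ne) h4 h4' ?_ fun x => ?_
    · refine (famNorm_le_mul hp (ENNReal.ofReal η) (b := fun k : Fin n => m k) fun k => ?_).trans
        (by gcongr; exact famNorm_comp_le hp m Fin.val_injective)
      rw [enorm_smul, mul_comm]
      gcongr
      rw [← ofReal_norm]
      exact ENNReal.ofReal_le_ofReal (hqD k)
    · calc C * (ENNReal.ofReal η * famNorm p m) = ENNReal.ofReal η * (C * famNorm p m) := by ring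
        _ ≤ _ := hηC
    · rw [Fin.sum_univ_eq_sum_range (fun k => x' k x • m k • (v k - q k - D k)) n]
      simp
  have ht : HasRep p (∑ k ∈ Finset.range n, (x' k).smulRight ((Set.Ici n₀).indicator s k))
      (δ / 2) := by
    refine hasRep_of_mul_le hp (ι := Fin n) (x' := fun k => x' k)
      (y := fun k => (Set.Ici n₀).indicator s k) (B := ENNReal.ofReal θ)
      (hx.comp_injective hp Fin.val_injective)
      ((famNorm_comp_le hp _ Fin.val_injective).trans (hn₀ n₀ le_rfl)) hC
      ENNReal.ofReal_ne_top h2 h2' (by rwa [mul_comm]) fun x => ?_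
    rw [Fin.sum_univ_eq_sum_range (fun k => x' k x • (Set.Ici n₀).indicator s k) n]
    simp
  convert (hr.add hp hn).add hp ht using 1
  · refine ContinuousLinearMap.ext fun x => ?_
    have hsplit : ∑ k ∈ Finset.range n, x' k x • (Set.Ici n₀).indicator s k
        = ∑ k ∈ Finset.range n, x' k x • s k - inclusionInDoubleDual 𝕜 Y (u x) := by
      have hu' : inclusionInDoubleDual 𝕜 Y (u x)
          = ∑ k ∈ Finset.range n, if k < n₀ then x' k x • s k else 0 := by
        rw [hux, map_sum, ← Finset.sum_filter, Fin.sum_univ_eq_sum_range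
          (fun k => inclusionInDoubleDual 𝕜 Y (x' k x • m k • z k)) n₀]
        refine Finset.sum_congr ?_ fun k _ => ?_
        · ext k
          simp only [Finset.mem_range, Finset.mem_filter]
          omega
        · have hzk : inclusionInDoubleDual 𝕜 Y (z k) = q k := hz k
          rw [map_smul, map_smul, hzk]
      rw [hu', ← Finset.sum_sub_distrib]
      refine Finset.sum_congr rfl fun k _ => ?_
      by_cases hk : n₀ ≤ k
      · simp [Set.indicator, hk, not_lt.2 hk]
      · simp [Set.indicator, hk, not_le.1 hk]
    have hsk : ∀ k, m k • q k = s k := fun _ => rfl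
    simp only [_root_.sub_apply, _root_.add_apply, _root_.sum_apply,
      ContinuousLinearMap.smulRight_apply, ContinuousLinearMap.comp_apply, hmv, smul_sub,
      Finset.sum_sub_distrib, hsk, hsplit]
    abel
  · rw [ENNReal.add_halves, ENNReal.add_halves]

end TripleDualRep

end

end PNuclear

theorem theorem1 {𝕜 : Type*} [RCLike 𝕜]
    {X : Type*} [NormedAddCommGroup X] [NormedSpace 𝕜 X] [CompleteSpace X]
    {Y : Type*} [NormedAddCommGroup Y] [NormedSpace 𝕜 Y] [CompleteSpace Y]
    (p : ℝ≥0∞) (hp : 1 ≤ p) (T : X →L[𝕜] Y) :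
    (PNuclear.IsNpOperator p ((NormedSpace.inclusionInDoubleDual 𝕜 Y).comp T) ↔
      PNuclear.IsPNuclear p (PNuclear.adjointOp T)) ∧
    (PNuclear.HasAP 𝕜 (StrongDual 𝕜 X) ∨
        PNuclear.HasAP 𝕜 (StrongDual 𝕜 (StrongDual 𝕜 (StrongDual 𝕜 Y))) →
      PNuclear.IsNpOperator p ((NormedSpace.inclusionInDoubleDual 𝕜 Y).comp T) →
      PNuclear.IsNpOperator p T) := by
  refine ⟨PNuclear.isPNuclear_adjointOp_iff hp T, ?_⟩
  rintro hAP ⟨x', y, hy, hx, hT⟩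
  obtain ⟨C, hC, hsb⟩ := PNuclear.synthBound_of_iSup_lt_top hp hx
  refine PNuclear.isNpOperator_of_forall_exists_hasRep hp
    (t := fun n => ∑ k ∈ Finset.range n, (x' k).smulRight (y k)) (fun x => ?_) fun δ hδ hδ' => ?_
  · simpa using (hT x).tendsto_sum_nat
  · rcases hAP with hAP | hAP
    · exact PNuclear.exists_hasRep_of_hasAP_dual hp hAP hsb hC hy hT hδ hδ'
    · exact PNuclear.exists_hasRep_of_hasAP_tripleDual hp hAP hsb hC hy hT hδ hδ'
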